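/- Let $n\ge 3$. For a forcing term $F:[0,1]\times\mathbb R^n\to\mathbb C$ and $2\le t\le 3$, $x\in\mathbb R^n$, put $$u(t,x)=(4\pi)^{-n/2}\int_0^1\int_{\mathbb R^n}\frac{e^{-i|x-y|^2/(4(t-s))}}{(t-s)^{n/2}}\,F(s,y)\,dy\,ds ,$$ which, up to a constant factor of modulus $1$, is the solution of $i\partial_tu-\Delta u=F$, $u(0,\cdot)=0$, when $F$ is extended by zero to $s\notin[0,1]$. For an interval $J$ write $\|G\|_{L^r(\mathbb R^n;L^q(J))}$ for the mixed norm in which the $L^q(J)$ norm in time is computed first and the $L^r(\mathbb R^n)$ norm in space second, and let $p'$ denote the conjugate exponent of $p\in[1,\infty]$. (a) *The test forcing term.* For $R\ge 1$ and $0<\eta<1$ let $F_{R,\eta}(s,y)=e^{2iR^2s^2}\chi(Ry/\eta)$, where $\chi$ is the characteristic function of the unit ball of $\mathbb R^n$ centered at the origin, and let $u_{R,\eta}$ be the corresponding $u$. There are constants $c,C>0$, $\eta_0\in(0,1)$ and $R_0\ge1$, depending only on $n$, such that for all $0<\eta\le\eta_0$ and $R\ge R_0$: - $|u_{R,\eta}(t,x)|\ge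 c\,\eta^n/R^{n+1}$ whenever $2\le t\le3$ and $R+\eta/R<|x|<2R-\eta/R$; - for all $q,r,\tilde q,\tilde r\in[1,\infty]$, $$c\,(\eta/R)^{n/\tilde r'}\le\|F_{R,\eta}\|_{L^{\tilde r'}(\mathbb R^n;L^{\tilde q'}([0,1]))}\le C\,(\eta/R)^{n/\tilde r'} ,$$ $$\frac{\|u_{R,\eta}\|_{L^r(\mathbb R^n;L^q([2,3]))}}{\|F_{R,\eta}\|_{L^{\tilde r'}(\mathbb R^n;L^{\tilde q'}([0,1]))}}\ge c\,\eta^{n/\tilde r}\,R^{\,n(1/r-1/\tilde r)-1} .$$ (b) *Necessary conditions.* Let $q,r,\tilde q,\tilde r\in[1,\infty]$ and suppose that there is a constant $K$ such that $$\|u\|_{L^r(\mathbb R^n;L^q([2,3]))}\le K\,\|F\|_{L^{\tilde r'}(\mathbb R^n;L^{\tilde q'}([0,1]))}$$ for every bounded measurable $F$ with bounded support. Then $$\frac1r-\frac1{\tilde r}\le\frac1n\qquad\text{and}\qquad\frac1{\tilde r}-\frac1r\le\frac1n .$$ Thus the condition $|1/r-1/\tilde r|<1/n$, under which (for $r,\tilde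 r\in[2,\infty]$) the estimate is known to hold for some $q,\tilde q\in[1,\infty]$, is sharp up to its endpoints. -/

import Mathlib

open MeasureTheory
open scoped ENNReal NNReal

noncomputable section

/-- The mixed norm `‖G‖_{L^r(ℝⁿ; L^q(J))}` of a function `G(t, x)`: the `L^q` norm in the time
variable over `J` is taken first, then the `L^r` norm in the space variable over `ℝⁿ`. -/
def mixedNorm {n : ℕ} (r q : ℝ≥0∞) (J : Set ℝ) (G : ℝ → EuclideanSpace ℝ (Fin n) → ℂ) : ℝ≥0∞ :=
  eLpNorm (fun x : EuclideanSpace ℝ (Fin n) =>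
    eLpNorm (fun t : ℝ => G t x) q (volume.restrict J)) r volume

/-- The solution `u(t, x)`, for `t ≥ 2`, with zero initial data and forcing term `F` supported in
`0 ≤ s ≤ 1`, written through the fundamental solution:
`u(t,x) = (4π)^{-n/2} ∫₀¹ ∫_{ℝⁿ} e^{-i|x-y|²/(4(t-s))} (t-s)^{-n/2} F(s,y) dy ds`. -/
def schrodingerSol {n : ℕ} (F : ℝ → EuclideanSpace ℝ (Fin n) → ℂ)
    (t : ℝ) (x : EuclideanSpace ℝ (Fin n)) : ℂ :=
  (((4 * Real.pi) ^ (-(n : ℝ) / 2) : ℝ) : ℂ) *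
    ∫ s in (0 : ℝ)..1, ∫ y : EuclideanSpace ℝ (Fin n),
      Complex.exp (-(Complex.I * ((‖x - y‖ ^ 2 / (4 * (t - s)) : ℝ) : ℂ))) /
        (((t - s) ^ ((n : ℝ) / 2) : ℝ) : ℂ) * F s y

/-- The estimate `‖u‖_{L^r(ℝⁿ; L^q([2,3]))} ≤ C ‖F‖_{L^{r̃'}(ℝⁿ; L^{q̃'}([0,1]))}`, with a constant
`C` independent of `F`. It is only required for bounded measurable `F` with bounded support in
space, for which the integral defining `u` converges absolutely. -/
def LocalMixedEstimate (n : ℕ) (q r qt rt : ℝ≥0∞) : Prop :=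
  ∃ C : ℝ≥0, ∀ F : ℝ → EuclideanSpace ℝ (Fin n) → ℂ,
    Measurable (Function.uncurry F) →
    (∃ M : ℝ, ∀ s y, ‖F s y‖ ≤ M) →
    (∃ ρ : ℝ, ∀ s y, ρ < ‖y‖ → F s y = 0) →
      mixedNorm r q (Set.Icc 2 3) (schrodingerSol F) ≤
        C * mixedNorm rt.conjExponent qt.conjExponent (Set.Icc 0 1) F

/-- The test forcing term `F(s,y) = e^{2iR²s²} χ(Ry/η)`, where `χ` is the characteristic function
of the unit ball. -/
def testForcing (n : ℕ) (R η : ℝ) (s : ℝ) (y : EuclideanSpace ℝ (Fin n)) : ℂ :=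
  Complex.exp (Complex.I * ((2 * R ^ 2 * s ^ 2 : ℝ) : ℂ)) *
    (Metric.ball (0 : EuclideanSpace ℝ (Fin n)) 1).indicator (fun _ => (1 : ℂ)) ((R / η) • y)

end

/-! Integrating in `s` first, `u(t, x)` is a constant times the integral over `|y| < η/R` of `Q =
∫₀¹ e^{iφ(s)} (t-s)^{-n/2} ds`, where `φ(s) = 2R²s² - ρ²/(4(t-s))` and `ρ = |x-y|`. For `0 < ρ ≤ 2R`
and `t ≥ 2` the phase is uniformly convex, `2R² ≤ φ'' ≤ 4R²`, with its minimum at some `s₀ ∈ (0,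
1/4)`, so `Q` should have size `1/R`.

The lower bound needs no stationary phase expansion. The imaginary part of `e^{-iφ(s₀)} Q` is `∫
sin(φ - φ(s₀)) w` with `w = (t-s)^{-n/2}`. On each side of `s₀`, write `θ = φ - φ(s₀)` as a function
of the distance to `s₀`; integration by parts through `sin θ · θ' = (1 - cos θ)'` leaves only
nonnegative terms as long as `w/θ'` decreases (`mul_sub_le_integral_sin_mul`). The left side
contributes at least `0`, however close `s₀` is to the endpoint `0`; the right side contributes
`c/R`; what remains far to the right is `O(R⁻²)` by the first-derivative test.

Replacing `|x|` by `|x-y|` multiplies the integrand by a slowly varying factor that is `1 + O(η)`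
with its derivative. The second-derivative test applied to the difference therefore gives `O(η/R)`
instead of `O(η)`, so a small `η` independent of `R` suffices. Hence `|u| ≥ c (η/R)ⁿ/R` on a set
containing a ball of radius `R/4`, and the norms follow.

For the necessary conditions, fix `η` and let `R → ∞`. The ratio of norms gives the first
inequality. The second is its dual: the kernel depends only on `t-s` and `|x-y|`, so the solution
operator followed by `t ↦ 3-t` is symmetric. With `g` the test forcing, supported in a ball `B`, and
`A` a ball on which `|u_g| ≥ m`, the forcing `F = m/u_g` on `A` pairs with `u_g` to give `m|A|`, and
Hölder turns the estimate for `F` into `m|A| ≤ K |A|^{1-1/r̃} |B|^{1-1/r}`. -/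

noncomputable section

/-! ### Oscillatory integrals with convex phase -/

open Complex in
/-- First-derivative test for oscillatory integrals with a convex phase. -/
theorem norm_integral_exp_mul_le_of_le_abs_deriv {a b μ M : ℝ} (hab : a ≤ b) (hb : b - a ≤ 1)
    (hμ : 0 < μ) {φ φ₁ φ₂ : ℝ → ℝ} {ψ ψ₁ : ℝ → ℂ}
    (hφ : ∀ s ∈ Set.Icc a b, HasDerivAt φ (φ₁ s) s)
    (hφ₁ : ∀ s ∈ Set.Icc a b, HasDerivAt φ₁ (φ₂ s) s)
    (hφ₂ : ContinuousOn φ₂ (Set.Icc a b)) (hconv : ∀ s ∈ Set.Icc a b, 0 ≤ φ₂ s)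
    (hlow : ∀ s ∈ Set.Icc a b, μ ≤ |φ₁ s|)
    (hψ : ∀ s ∈ Set.Icc a b, HasDerivAt ψ (ψ₁ s) s)
    (hψ₁ : ContinuousOn ψ₁ (Set.Icc a b))
    (hM : ∀ s ∈ Set.Icc a b, ‖ψ s‖ ≤ M) (hM₁ : ∀ s ∈ Set.Icc a b, ‖ψ₁ s‖ ≤ M) :
    ‖∫ s in a..b, cexp (I * φ s) * ψ s‖ ≤ 5 * M / μ := by
  have hM0 : 0 ≤ M := (norm_nonneg _).trans (hM a ⟨le_rfl, hab⟩)
  have hu : Set.uIcc a b = Set.Icc a b := Set.uIcc_of_le hab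
  have hne : ∀ s ∈ Set.Icc a b, φ₁ s ≠ 0 := fun s hs => abs_pos.1 (hμ.trans_le (hlow s hs))
  have hneC : ∀ s ∈ Set.Icc a b, (φ₁ s : ℂ) ≠ 0 := fun s hs => by exact_mod_cast hne s hs
  have cφ : ContinuousOn φ (Set.Icc a b) := fun s hs => (hφ s hs).continuousAt.continuousWithinAt
  have cφ₁ : ContinuousOn φ₁ (Set.Icc a b) :=
    fun s hs => (hφ₁ s hs).continuousAt.continuousWithinAt
  have cψ : ContinuousOn ψ (Set.Icc a b) := fun s hs => (hψ s hs).continuousAt.continuousWithinAt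
  have cφC : ContinuousOn (fun s => (φ s : ℂ)) (Set.Icc a b) :=
    continuous_ofReal.comp_continuousOn cφ
  have cφ₁C : ContinuousOn (fun s => (φ₁ s : ℂ)) (Set.Icc a b) :=
    continuous_ofReal.comp_continuousOn cφ₁
  have cφ₂C : ContinuousOn (fun s => (φ₂ s : ℂ)) (Set.Icc a b) :=
    continuous_ofReal.comp_continuousOn hφ₂
  have cE : ContinuousOn (fun s => cexp (I * φ s)) (Set.Icc a b) := by fun_prop
  -- the primitive and the remainder of the integration by parts
  set H : ℝ → ℂ := fun s => cexp (I * φ s) * ψ s / (I * φ₁ s) with hH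
  set E : ℝ → ℂ := fun s => cexp (I * φ s) * (ψ₁ s / (I * φ₁ s) - ψ s * φ₂ s / (I * φ₁ s ^ 2))
    with hE
  have cEE : ContinuousOn E (Set.Icc a b) := by
    refine cE.mul ((hψ₁.div (continuousOn_const.mul cφ₁C) ?_).sub
      ((cψ.mul cφ₂C).div (continuousOn_const.mul (cφ₁C.pow 2)) ?_))
    · intro s hs; exact mul_ne_zero I_ne_zero (hneC s hs)
    · intro s hs; exact mul_ne_zero I_ne_zero (pow_ne_zero _ (hneC s hs))
  have hder : ∀ s ∈ Set.uIcc a b, HasDerivAt H (cexp (I * φ s) * ψ s + E s) s := by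
    intro s hs
    rw [hu] at hs
    have h1 := ((hφ s hs).ofReal_comp.const_mul I).cexp
    have h2 := ((hφ₁ s hs).ofReal_comp.const_mul I)
    have h3 := (h1.mul (hψ s hs)).div h2 (mul_ne_zero I_ne_zero (hneC s hs))
    refine h3.congr_deriv ?_
    have := hneC s hs
    simp only [hE, Pi.mul_apply]
    field_simp
    ring
  have i1 : IntervalIntegrable (fun s => cexp (I * φ s) * ψ s) volume a b := by
    apply ContinuousOn.intervalIntegrable; rw [hu]; exact cE.mul cψ
  have i2 : IntervalIntegrable E volume a b := by
    apply ContinuousOn.intervalIntegrable; rw [hu]; exact cEE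
  have key := intervalIntegral.integral_eq_sub_of_hasDerivAt hder (i1.add i2)
  rw [intervalIntegral.integral_add i1 i2] at key
  have hnE : ∀ s, ‖cexp (I * φ s)‖ = 1 := fun s => by
    rw [mul_comm]; exact norm_exp_ofReal_mul_I _
  have hHb : ∀ s ∈ Set.Icc a b, ‖H s‖ ≤ M / μ := by
    intro s hs
    simp only [hH, norm_div, norm_mul, hnE, norm_I, one_mul, norm_real, Real.norm_eq_abs]
    exact div_le_div₀ hM0 (hM s hs) hμ (hlow s hs)
  have cinv : ContinuousOn (fun s => φ₂ s / φ₁ s ^ 2) (Set.Icc a b) :=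
    hφ₂.div (cφ₁.pow 2) fun s hs => pow_ne_zero _ (hne s hs)
  have i3 : IntervalIntegrable (fun s => φ₂ s / φ₁ s ^ 2) volume a b := by
    apply ContinuousOn.intervalIntegrable; rw [hu]; exact cinv
  -- Convexity lets `φ₂ / φ₁ ^ 2` stand without absolute values. It is the exact derivative of
  -- `-1/φ₁`, so its integral is at most `2/μ` however large `φ₂` is.
  have hEb : ‖∫ s in a..b, E s‖ ≤ ∫ s in a..b, (M / μ + M * (φ₂ s / φ₁ s ^ 2)) := by
    refine intervalIntegral.norm_integral_le_of_norm_le hab ?_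
      (intervalIntegrable_const.add (i3.const_mul M))
    refine Filter.Eventually.of_forall fun s hs' => ?_
    have hs : s ∈ Set.Icc a b := ⟨hs'.1.le, hs'.2⟩
    simp only [hE, norm_mul, hnE, one_mul]
    refine (norm_sub_le _ _).trans (add_le_add ?_ ?_)
    · simp only [norm_div, norm_mul, norm_I, one_mul, norm_real, Real.norm_eq_abs]
      exact div_le_div₀ hM0 (hM₁ s hs) hμ (hlow s hs)
    · simp only [norm_div, norm_mul, norm_I, one_mul, norm_real, Real.norm_eq_abs, norm_pow, sq_abs,
        abs_of_nonneg (hconv s hs)]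
      rw [mul_div_assoc]
      exact mul_le_mul_of_nonneg_right (hM s hs) (div_nonneg (hconv s hs) (sq_nonneg _))
  have hinv : ∫ s in a..b, φ₂ s / φ₁ s ^ 2 = -(φ₁ b)⁻¹ - -(φ₁ a)⁻¹ := by
    refine intervalIntegral.integral_eq_sub_of_hasDerivAt (f := fun s => -(φ₁ s)⁻¹)
      (fun s hs => ?_) i3
    rw [hu] at hs
    refine ((hφ₁ s hs).inv (hne s hs)).neg.congr_deriv ?_
    ring
  have hinvb : ∀ s ∈ Set.Icc a b, |(φ₁ s)⁻¹| ≤ 1 / μ := by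
    intro s hs
    rw [abs_inv, ← one_div]
    exact one_div_le_one_div_of_le hμ (hlow s hs)
  rw [intervalIntegral.integral_add intervalIntegrable_const (i3.const_mul M),
    intervalIntegral.integral_const, intervalIntegral.integral_const_mul, hinv, smul_eq_mul] at hEb
  have ha := hinvb a ⟨le_rfl, hab⟩
  have hb' := hinvb b ⟨hab, le_rfl⟩
  have e1 : -(φ₁ b)⁻¹ - -(φ₁ a)⁻¹ ≤ 2 * (1 / μ) := by
    linarith [(abs_le.1 ha).2, (abs_le.1 hb').1]
  have e2 : (b - a) * (M / μ) ≤ M / μ := mul_le_of_le_one_left (by positivity) hb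
  have e3 := mul_le_mul_of_nonneg_left e1 hM0
  have : ∫ s in a..b, cexp (I * φ s) * ψ s = H b - H a - ∫ s in a..b, E s := by
    rw [← key]; ring
  rw [this]
  calc ‖H b - H a - ∫ s in a..b, E s‖ ≤ ‖H b‖ + ‖H a‖ + ‖∫ s in a..b, E s‖ :=
        (norm_sub_le _ _).trans (by gcongr; exact norm_sub_le _ _)
    _ ≤ M / μ + M / μ + (M / μ + M * (2 * (1 / μ))) := by
        have := hHb a ⟨le_rfl, hab⟩
        have := hHb b ⟨hab, le_rfl⟩
        linarith
    _ = 5 * M / μ := by ring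

/-- A lower bound for `∫ sin θ · w` when `θ` starts at a nondegenerate minimum and the weight
`w / θ'` is decreasing, from the integration by parts `sin θ · θ' = (1 - cos θ)'`. -/
theorem mul_sub_le_integral_sin_mul {d p q m R : ℝ} (hp : 0 < p) (hpq : p ≤ q) (hqd : q ≤ d)
    (hR : 0 < R) {θ θ₁ θ₂ w w₁ : ℝ → ℝ}
    (hθ : ∀ u ∈ Set.Icc 0 d, HasDerivAt θ (θ₁ u) u)
    (hθ₁ : ∀ u ∈ Set.Icc 0 d, HasDerivAt θ₁ (θ₂ u) u)
    (hlow : ∀ u ∈ Set.Icc 0 d, 2 * R ^ 2 * u ≤ θ₁ u)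
    (hupp : ∀ u ∈ Set.Icc 0 d, θ u ≤ 2 * R ^ 2 * u ^ 2)
    (hpos : ∀ u ∈ Set.Icc 0 d, 0 ≤ θ u)
    (hw : ∀ u ∈ Set.Icc 0 d, HasDerivAt w (w₁ u) u)
    (hw0 : ∀ u ∈ Set.Icc 0 d, 0 ≤ w u) (hw1 : ∀ u ∈ Set.Icc 0 d, w u ≤ 1)
    (hdec : ∀ u ∈ Set.Icc 0 d, w₁ u * θ₁ u ≤ w u * θ₂ u)
    (hmb : ∀ u ∈ Set.Icc p q,
      m ≤ (1 - Real.cos (θ u)) * (w u * θ₂ u - w₁ u * θ₁ u) / θ₁ u ^ 2) :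
    m * (q - p) ≤ ∫ u in 0..d, Real.sin (θ u) * w u := by
  have hd : 0 < d := hp.trans_le (hpq.trans hqd)
  have cθ : ContinuousOn θ (Set.Icc 0 d) := fun s hs => (hθ s hs).continuousAt.continuousWithinAt
  have cw : ContinuousOn w (Set.Icc 0 d) := fun s hs => (hw s hs).continuousAt.continuousWithinAt
  have cf : ContinuousOn (fun u => Real.sin (θ u) * w u) (Set.Icc 0 d) :=
    (Real.continuous_sin.comp_continuousOn cθ).mul cw
  have ii : ∀ x ∈ Set.Icc 0 d, ∀ y ∈ Set.Icc 0 d,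
      IntervalIntegrable (fun u => Real.sin (θ u) * w u) volume x y := fun x hx y hy =>
    (cf.mono (Set.uIcc_subset_Icc hx hy)).intervalIntegrable
  set J : ℝ → ℝ := fun x => ∫ u in 0..x, Real.sin (θ u) * w u with hJ
  -- `H' = sin θ · w - W`, where `W ≥ 0` says exactly that `w/θ'` decreases. So `J - H` is
  -- nondecreasing on `(0, d]`, and it gains at least `m * (q - p)` across `[p, q]`.
  set H : ℝ → ℝ := fun u => (1 - Real.cos (θ u)) * w u / θ₁ u with hH
  set W : ℝ → ℝ := fun u => (1 - Real.cos (θ u)) * (w u * θ₂ u - w₁ u * θ₁ u) / θ₁ u ^ 2 with hW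
  have hθ₁pos : ∀ u ∈ Set.Ioc 0 d, 0 < θ₁ u := fun u hu =>
    (by have := hu.1; positivity : 0 < 2 * R ^ 2 * u).trans_le (hlow u ⟨hu.1.le, hu.2⟩)
  have hcos : ∀ x : ℝ, 0 ≤ 1 - Real.cos x := fun x => by linarith [Real.cos_le_one x]
  have hWnn : ∀ u ∈ Set.Ioc 0 d, 0 ≤ W u := fun u hu =>
    div_nonneg (mul_nonneg (hcos _) (sub_nonneg.2 (hdec u ⟨hu.1.le, hu.2⟩))) (sq_nonneg _)
  have hHd : ∀ u ∈ Set.Ioc 0 d, HasDerivAt H (Real.sin (θ u) * w u - W u) u := by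
    intro u hu
    have hu' : u ∈ Set.Icc 0 d := ⟨hu.1.le, hu.2⟩
    have h1 := (((hθ u hu').cos.const_sub 1).mul (hw u hu')).div (hθ₁ u hu') (hθ₁pos u hu).ne'
    refine h1.congr_deriv ?_
    have := (hθ₁pos u hu).ne'
    simp only [hW, Pi.mul_apply]
    field_simp
    ring
  have hJd : ∀ u ∈ Set.Ioo 0 d, HasDerivAt J (Real.sin (θ u) * w u) u := by
    intro u hu
    have hu' : u ∈ Set.Icc 0 d := ⟨hu.1.le, hu.2.le⟩
    refine intervalIntegral.integral_hasDerivAt_right (ii 0 ⟨le_rfl, hd.le⟩ u hu') ?_ ?_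
    · exact ContinuousOn.stronglyMeasurableAtFilter isOpen_Ioo
        (cf.mono Set.Ioo_subset_Icc_self) u hu
    · exact cf.continuousAt (Icc_mem_nhds hu.1 hu.2)
  have cJ : ContinuousOn J (Set.Icc 0 d) := by
    have := intervalIntegral.continuousOn_primitive_interval' (ii 0 ⟨le_rfl, hd.le⟩ d ⟨hd.le, le_rfl⟩)
      (Set.left_mem_uIcc)
    rwa [Set.uIcc_of_le hd.le] at this
  have cH : ContinuousOn H (Set.Ioc 0 d) :=
    fun s hs => (hHd s hs).continuousAt.continuousWithinAt
  have hDd : ∀ u ∈ Set.Ioo 0 d, HasDerivAt (fun u => J u - H u) (W u) u := fun u hu =>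
    ((hJd u hu).sub (hHd u ⟨hu.1, hu.2.le⟩)).congr_deriv (by ring)
  have hmono : ∀ x ∈ Set.Ioc 0 d, ∀ y ∈ Set.Icc x d, ∀ k, (∀ u ∈ Set.Icc x y, k ≤ W u) →
      k * (y - x) ≤ (J y - H y) - (J x - H x) := by
    intro x hx y hy k hk
    have hsub : Set.Icc x y ⊆ Set.Ioc 0 d := fun u hu => ⟨hx.1.trans_le hu.1, hu.2.trans hy.2⟩
    refine Convex.mul_sub_le_image_sub_of_le_deriv (D := Set.Icc x y) (f := fun u => J u - H u)
      (convex_Icc _ _)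
      ((cJ.mono (hsub.trans Set.Ioc_subset_Icc_self)).sub (cH.mono hsub)) ?_ ?_ x ⟨le_rfl, hy.1⟩ y
      ⟨hy.1, le_rfl⟩ hy.1
    all_goals
      intro u hu
      rw [interior_Icc] at hu
      have hu2 : u ∈ Set.Ioo 0 d := ⟨hx.1.trans hu.1, hu.2.trans_le hy.2⟩
    · exact (hDd u hu2).differentiableAt.differentiableWithinAt
    · rw [(hDd u hu2).deriv]; exact hk u ⟨hu.1.le, hu.2.le⟩
  have hqI : q ∈ Set.Ioc 0 d := ⟨hp.trans_le hpq, hqd⟩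
  have s1 := hmono p ⟨hp, hpq.trans hqd⟩ q ⟨hpq, hqd⟩ m hmb
  have s2 := hmono q hqI d ⟨hqd, le_rfl⟩ 0 fun u hu => hWnn u ⟨hqI.1.trans_le hu.1, hu.2⟩
  have s3 : 0 ≤ H d := div_nonneg (mul_nonneg (hcos _) (hw0 d ⟨hd.le, le_rfl⟩))
    (hθ₁pos d ⟨hd, le_rfl⟩).le
  -- The quotient `H` is of the form `0/0` at the critical point, so the argument starts at `ε > 0`.
  -- The error `R²ε³` bounds `H ε`: its numerator is at most `θ²/2 ≤ 2R⁴ε⁴` and its denominator at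
  -- least `2R²ε`.
  have hlim : Filter.Tendsto (fun ε : ℝ => m * (q - p) - R ^ 2 * ε ^ 3)
      (nhdsWithin 0 (Set.Ioi 0)) (nhds (m * (q - p))) := by
    have : Continuous fun ε : ℝ => m * (q - p) - R ^ 2 * ε ^ 3 := by fun_prop
    have h := this.tendsto 0
    simp only [ne_eq, OfNat.ofNat_ne_zero, not_false_eq_true, zero_pow, mul_zero, sub_zero] at h
    exact h.mono_left nhdsWithin_le_nhds
  refine le_of_tendsto hlim ?_
  filter_upwards [Ioo_mem_nhdsGT (lt_min hp (show 0 < 1 / R by positivity))] with ε hε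
  have hε0 : 0 < ε := hε.1
  have hεp : ε < p := hε.2.trans_le (min_le_left _ _)
  have hεR : ε * R < 1 := by
    have := hε.2.trans_le (min_le_right _ _)
    rwa [lt_div_iff₀ hR] at this
  have hεd : ε ≤ d := hεp.le.trans (hpq.trans hqd)
  have s4 := hmono ε ⟨hε0, hεd⟩ p ⟨hεp.le, hpq.trans hqd⟩ 0
    fun u hu => hWnn u ⟨hε0.trans_le hu.1, hu.2.trans (hpq.trans hqd)⟩
  -- For `u ≤ ε < 1/R` the phase stays in `[0, 2]`, inside `[0, π]`, where the sine is nonnegative.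
  have s5 : 0 ≤ J ε := by
    refine intervalIntegral.integral_nonneg hε0.le fun u hu => ?_
    have hu' : u ∈ Set.Icc 0 d := ⟨hu.1, hu.2.trans hεd⟩
    refine mul_nonneg (Real.sin_nonneg_of_nonneg_of_le_pi (hpos u hu') ?_) (hw0 u hu')
    have h1 := hupp u hu'
    have h2 : u * R ≤ 1 := (mul_le_mul_of_nonneg_right hu.2 hR.le).trans hεR.le
    have h3 : 0 ≤ u * R := mul_nonneg hu.1 hR.le
    nlinarith [Real.pi_gt_three]
  have s6 : H ε ≤ R ^ 2 * ε ^ 3 := by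
    have hu' : ε ∈ Set.Icc 0 d := ⟨hε0.le, hεd⟩
    have hc : 1 - Real.cos (θ ε) ≤ (θ ε) ^ 2 / 2 := by
      linarith [Real.one_sub_sq_div_two_le_cos (x := θ ε)]
    have h1 := hupp ε hu'
    have h2 : (θ ε) ^ 2 ≤ (2 * R ^ 2 * ε ^ 2) ^ 2 := pow_le_pow_left₀ (hpos ε hu') h1 2
    rw [hH]
    simp only
    rw [div_le_iff₀ (hθ₁pos ε ⟨hε0, hεd⟩)]
    calc (1 - Real.cos (θ ε)) * w ε ≤ (1 - Real.cos (θ ε)) * 1 :=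
          mul_le_mul_of_nonneg_left (hw1 ε hu') (hcos _)
      _ ≤ R ^ 2 * ε ^ 3 * (2 * R ^ 2 * ε) := by nlinarith
      _ ≤ R ^ 2 * ε ^ 3 * θ₁ ε := mul_le_mul_of_nonneg_left (hlow ε hu') (by positivity)
  show _ ≤ J d
  linarith

theorem image_zero_le_of_hasDerivAt_nonneg {f f' : ℝ → ℝ} {d : ℝ}
    (hf : ∀ u ∈ Set.Icc 0 d, HasDerivAt f (f' u) u) (hf' : ∀ u ∈ Set.Icc 0 d, 0 ≤ f' u)
    {u : ℝ} (hu : u ∈ Set.Icc 0 d) : f 0 ≤ f u := by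
  refine monotoneOn_of_deriv_nonneg (convex_Icc 0 d)
    (fun s hs => (hf s hs).continuousAt.continuousWithinAt) ?_ ?_ ⟨le_rfl, hu.1.trans hu.2⟩ hu hu.1
  all_goals
    intro s hs
    have hs' := interior_subset hs
  · exact (hf s hs').differentiableAt.differentiableWithinAt
  · rw [(hf s hs').deriv]; exact hf' s hs'

/-- Quadratic bounds at a critical point from two-sided bounds on the second derivative. -/
theorem quadratic_bounds_of_second_deriv {θ θ₁ θ₂ : ℝ → ℝ} {d k K : ℝ} (h0 : θ 0 = 0)
    (h1 : θ₁ 0 = 0) (hθ : ∀ u ∈ Set.Icc 0 d, HasDerivAt θ (θ₁ u) u)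
    (hθ₁ : ∀ u ∈ Set.Icc 0 d, HasDerivAt θ₁ (θ₂ u) u)
    (hk : ∀ u ∈ Set.Icc 0 d, 2 * k ≤ θ₂ u) (hK : ∀ u ∈ Set.Icc 0 d, θ₂ u ≤ 2 * K) :
    ∀ u ∈ Set.Icc 0 d, 2 * k * u ≤ θ₁ u ∧ θ₁ u ≤ 2 * K * u ∧ k * u ^ 2 ≤ θ u ∧
      θ u ≤ K * u ^ 2 := by
  have a1 : ∀ u ∈ Set.Icc 0 d, 2 * k * u ≤ θ₁ u := fun u hu => by
    have := image_zero_le_of_hasDerivAt_nonneg (f := fun u => θ₁ u - 2 * k * u)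
      (fun s hs => (hθ₁ s hs).sub ((hasDerivAt_id s).const_mul (2 * k)))
      (fun s hs => by linarith [hk s hs]) hu
    simp only [h1, mul_zero, sub_zero] at this
    linarith
  have a2 : ∀ u ∈ Set.Icc 0 d, θ₁ u ≤ 2 * K * u := fun u hu => by
    have := image_zero_le_of_hasDerivAt_nonneg (f := fun u => 2 * K * u - θ₁ u)
      (fun s hs => ((hasDerivAt_id s).const_mul (2 * K)).sub (hθ₁ s hs))
      (fun s hs => by linarith [hK s hs]) hu
    simp only [h1, mul_zero, sub_zero] at this
    linarith
  refine fun u hu => ⟨a1 u hu, a2 u hu, ?_, ?_⟩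
  · have := image_zero_le_of_hasDerivAt_nonneg (f := fun u => θ u - k * u ^ 2)
      (fun s hs => (hθ s hs).sub ((hasDerivAt_pow 2 s).const_mul k))
      (fun s hs => by
        have := a1 s hs
        simp only [Nat.cast_ofNat, Nat.add_one_sub_one, pow_one]; linarith) hu
    simp only [h0, ne_eq, OfNat.ofNat_ne_zero, not_false_eq_true, zero_pow, mul_zero,
      sub_zero] at this
    linarith
  · have := image_zero_le_of_hasDerivAt_nonneg (f := fun u => K * u ^ 2 - θ u)
      (fun s hs => ((hasDerivAt_pow 2 s).const_mul K).sub (hθ s hs))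
      (fun s hs => by
        have := a2 s hs
        simp only [Nat.cast_ofNat, Nat.add_one_sub_one, pow_one]; linarith) hu
    simp only [h0, ne_eq, OfNat.ofNat_ne_zero, not_false_eq_true, zero_pow, mul_zero,
      sub_zero] at this
    linarith

/-! ### The chirp phase and the kernel amplitude -/

/-- The phase of the solution generated by the chirp `e^{2iR²s²}` placed at distance `ρ`. -/
def chirpPhase (R ρ t s : ℝ) : ℝ := 2 * R ^ 2 * s ^ 2 - ρ ^ 2 / (4 * (t - s))

/-- The derivative of `chirpPhase` in `s`. -/
def chirpPhaseDeriv (R ρ t s : ℝ) : ℝ := 4 * R ^ 2 * s - ρ ^ 2 / (4 * (t - s) ^ 2)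

/-- The second derivative of `chirpPhase` in `s`. -/
def chirpPhaseDeriv₂ (R ρ t s : ℝ) : ℝ := 4 * R ^ 2 - ρ ^ 2 / (2 * (t - s) ^ 3)

/-- The amplitude `(t - s)^{-n/2}` of the Schrödinger kernel. -/
def kernelAmp (n : ℕ) (t s : ℝ) : ℝ := ((t - s) ^ ((n : ℝ) / 2))⁻¹

/-- The derivative of `kernelAmp` in `s`. -/
def kernelAmpDeriv (n : ℕ) (t s : ℝ) : ℝ := (n : ℝ) / 2 * kernelAmp n t s / (t - s)

theorem hasDerivAt_chirpPhase {R ρ t s : ℝ} (h : 0 < t - s) :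
    HasDerivAt (chirpPhase R ρ t) (chirpPhaseDeriv R ρ t s) s := by
  have h1 : HasDerivAt (fun s => 4 * (t - s)) (4 * (-1)) s :=
    ((hasDerivAt_id s).const_sub t).const_mul 4
  have := ((hasDerivAt_pow 2 s).const_mul (2 * R ^ 2)).sub
    ((hasDerivAt_const s (ρ ^ 2)).div h1 (by positivity))
  refine this.congr_deriv ?_
  have := h.ne'
  simp only [chirpPhaseDeriv]
  field_simp
  ring

theorem hasDerivAt_chirpPhaseDeriv {R ρ t s : ℝ} (h : 0 < t - s) :
    HasDerivAt (chirpPhaseDeriv R ρ t) (chirpPhaseDeriv₂ R ρ t s) s := by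
  have h1 := (((hasDerivAt_id s).const_sub t).pow 2).const_mul 4
  have := ((hasDerivAt_id s).const_mul (4 * R ^ 2)).sub
    ((hasDerivAt_const s (ρ ^ 2)).div h1 (by simp only [Pi.pow_apply, id]; positivity))
  refine this.congr_deriv ?_
  have := h.ne'
  simp only [chirpPhaseDeriv₂, Pi.pow_apply, id]
  field_simp
  ring

theorem kernelAmp_pos {n : ℕ} {t s : ℝ} (h : 0 < t - s) : 0 < kernelAmp n t s :=
  inv_pos.2 (Real.rpow_pos_of_pos h _)

theorem kernelAmp_le_one {n : ℕ} {t s : ℝ} (h : 1 ≤ t - s) : kernelAmp n t s ≤ 1 :=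
  inv_le_one_of_one_le₀ (Real.one_le_rpow h (by positivity))

theorem le_kernelAmp {n : ℕ} {t s : ℝ} (h : 0 < t - s) (h3 : t - s ≤ 3) :
    ((3 : ℝ) ^ ((n : ℝ) / 2))⁻¹ ≤ kernelAmp n t s :=
  inv_anti₀ (Real.rpow_pos_of_pos h _) (Real.rpow_le_rpow h.le h3 (by positivity))

theorem hasDerivAt_kernelAmp {n : ℕ} {t s : ℝ} (h : 0 < t - s) :
    HasDerivAt (kernelAmp n t) (kernelAmpDeriv n t s) s := by
  have h1 := (((hasDerivAt_id s).const_sub t).rpow_const (p := (n : ℝ) / 2)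
    (Or.inl h.ne')).inv (Real.rpow_pos_of_pos h _).ne'
  refine h1.congr_deriv ?_
  have := (Real.rpow_pos_of_pos h ((n : ℝ) / 2)).ne'
  simp only [kernelAmpDeriv, kernelAmp, id]
  rw [Real.rpow_sub_one h.ne']
  field_simp

theorem kernelAmpDeriv_nonneg {n : ℕ} {t s : ℝ} (h : 0 < t - s) : 0 ≤ kernelAmpDeriv n t s := by
  have := kernelAmp_pos (n := n) h
  unfold kernelAmpDeriv
  positivity

theorem kernelAmpDeriv_le {n : ℕ} {t s : ℝ} (h : 1 ≤ t - s) :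
    kernelAmpDeriv n t s ≤ n / 2 * kernelAmp n t s := by
  have := kernelAmp_pos (n := n) (t := t) (s := s) (by linarith)
  exact div_le_self (by positivity) h

theorem continuousOn_kernelAmpDeriv {n : ℕ} {t : ℝ} (ht : 2 ≤ t) :
    ContinuousOn (kernelAmpDeriv n t) (Set.Icc 0 1) := by
  have h : ContinuousOn (kernelAmp n t) (Set.Icc 0 1) := fun s hs =>
    (hasDerivAt_kernelAmp (by linarith [hs.2])).continuousAt.continuousWithinAt
  refine (continuousOn_const.mul h).div (by fun_prop) fun s hs => ?_
  linarith [hs.2]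

theorem continuousOn_chirpPhaseDeriv₂ {R ρ t : ℝ} (ht : 2 ≤ t) :
    ContinuousOn (chirpPhaseDeriv₂ R ρ t) (Set.Icc 0 1) := by
  unfold chirpPhaseDeriv₂
  refine continuousOn_const.sub (continuousOn_const.div (by fun_prop) fun s hs => ?_)
  have : 0 < t - s := by linarith [hs.2]
  positivity

/-- With `t - s ≥ 1` and `ρ ≤ 2R`, the kernel's contribution to the second derivative takes away at
most half of the `4R²` supplied by the chirp. -/
theorem chirpPhaseDeriv₂_bounds {R ρ t s : ℝ} (hρ0 : 0 ≤ ρ) (hρ : ρ ≤ 2 * R)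
    (ht : 2 ≤ t) (hs : s ≤ 1) :
    2 * R ^ 2 ≤ chirpPhaseDeriv₂ R ρ t s ∧ chirpPhaseDeriv₂ R ρ t s ≤ 4 * R ^ 2 := by
  have h1 : 1 ≤ (t - s) ^ 3 := one_le_pow₀ (by linarith)
  have h2 : ρ ^ 2 ≤ (2 * R) ^ 2 := pow_le_pow_left₀ hρ0 hρ 2
  have h3 : ρ ^ 2 / (2 * (t - s) ^ 3) ≤ 2 * R ^ 2 := by
    rw [div_le_iff₀ (by positivity)]
    nlinarith [sq_nonneg R]
  have h4 : 0 ≤ ρ ^ 2 / (2 * (t - s) ^ 3) := by positivity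
  unfold chirpPhaseDeriv₂
  constructor <;> linarith

/-- The derivative is negative at `0`, and at `1/4` the chirp supplies `R²` against less than `R²`
from the kernel. Keeping `s₀ < 1/4` leaves room inside `[0, 1]` for the intervals used to its right.
-/
theorem exists_chirpPhaseDeriv_eq_zero {R ρ t : ℝ} (hR : 0 < R) (hρ0 : 0 < ρ)
    (hρ : ρ ≤ 2 * R) (ht : 2 ≤ t) :
    ∃ s₀ ∈ Set.Ioo (0 : ℝ) (1 / 4), chirpPhaseDeriv R ρ t s₀ = 0 := by
  have hc : ContinuousOn (chirpPhaseDeriv R ρ t) (Set.Icc 0 (1 / 4)) := fun s hs =>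
    (hasDerivAt_chirpPhaseDeriv (by linarith [hs.2])).continuousAt.continuousWithinAt
  refine intermediate_value_Ioo (by norm_num) hc ⟨?_, ?_⟩
  · have : 0 < ρ ^ 2 / (4 * (t - 0) ^ 2) := by
      have : 0 < t - 0 := by linarith
      positivity
    unfold chirpPhaseDeriv
    linarith
  · have h2 : ρ ^ 2 ≤ (2 * R) ^ 2 := pow_le_pow_left₀ hρ0.le hρ 2
    have h3 : (7 / 4 : ℝ) ^ 2 ≤ (t - 1 / 4) ^ 2 :=
      pow_le_pow_left₀ (by norm_num) (by linarith) 2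
    have hR2 : 0 < R ^ 2 := by positivity
    have : ρ ^ 2 / (4 * (t - 1 / 4) ^ 2) < R ^ 2 := by
      rw [div_lt_iff₀ (by nlinarith)]
      nlinarith
    unfold chirpPhaseDeriv
    linarith

/-! ### Behaviour on either side of the critical point -/

section CriticalPoint

variable {R ρ t s₀ : ℝ}

theorem chirpPhase_right_bounds (hρ0 : 0 ≤ ρ) (hρ : ρ ≤ 2 * R) (ht : 2 ≤ t)
    (hs : chirpPhaseDeriv R ρ t s₀ = 0) :
    ∀ u ∈ Set.Icc 0 (1 - s₀), 2 * R ^ 2 * u ≤ chirpPhaseDeriv R ρ t (s₀ + u) ∧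
      chirpPhaseDeriv R ρ t (s₀ + u) ≤ 2 * (2 * R ^ 2) * u ∧
      R ^ 2 * u ^ 2 ≤ chirpPhase R ρ t (s₀ + u) - chirpPhase R ρ t s₀ ∧
      chirpPhase R ρ t (s₀ + u) - chirpPhase R ρ t s₀ ≤ 2 * R ^ 2 * u ^ 2 := by
  refine quadratic_bounds_of_second_deriv (θ := fun u => chirpPhase R ρ t (s₀ + u) -
    chirpPhase R ρ t s₀) (θ₁ := fun u => chirpPhaseDeriv R ρ t (s₀ + u))
    (θ₂ := fun u => chirpPhaseDeriv₂ R ρ t (s₀ + u)) (by simp) (by simpa using hs) ?_ ?_ ?_ ?_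
  all_goals
    intro u hu
    have hu2 := hu.2
  · exact ((hasDerivAt_chirpPhase (by linarith)).comp_const_add s₀ u).sub_const _
  · exact (hasDerivAt_chirpPhaseDeriv (by linarith)).comp_const_add s₀ u
  · exact (chirpPhaseDeriv₂_bounds hρ0 hρ ht (by linarith)).1
  · linarith [(chirpPhaseDeriv₂_bounds hρ0 hρ ht (by linarith : s₀ + u ≤ 1)).2]

theorem hasDerivAt_chirpPhase_left {u : ℝ} (h : 0 < t - (s₀ - u)) :
    HasDerivAt (fun u => chirpPhase R ρ t (s₀ - u) - chirpPhase R ρ t s₀)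
      (-chirpPhaseDeriv R ρ t (s₀ - u)) u :=
  ((hasDerivAt_chirpPhase h).comp_const_sub s₀ u).sub_const _

theorem hasDerivAt_chirpPhaseDeriv_left {u : ℝ} (h : 0 < t - (s₀ - u)) :
    HasDerivAt (fun u => -chirpPhaseDeriv R ρ t (s₀ - u))
      (chirpPhaseDeriv₂ R ρ t (s₀ - u)) u :=
  ((hasDerivAt_chirpPhaseDeriv h).comp_const_sub s₀ u).neg.congr_deriv (neg_neg _)

theorem chirpPhase_left_bounds (hρ0 : 0 ≤ ρ) (hρ : ρ ≤ 2 * R) (ht : 2 ≤ t)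
    (h1 : s₀ ≤ 1) (hs : chirpPhaseDeriv R ρ t s₀ = 0) :
    ∀ u ∈ Set.Icc 0 s₀, 2 * R ^ 2 * u ≤ -chirpPhaseDeriv R ρ t (s₀ - u) ∧
      -chirpPhaseDeriv R ρ t (s₀ - u) ≤ 2 * (2 * R ^ 2) * u ∧
      R ^ 2 * u ^ 2 ≤ chirpPhase R ρ t (s₀ - u) - chirpPhase R ρ t s₀ ∧
      chirpPhase R ρ t (s₀ - u) - chirpPhase R ρ t s₀ ≤ 2 * R ^ 2 * u ^ 2 := by
  refine quadratic_bounds_of_second_deriv (θ := fun u => chirpPhase R ρ t (s₀ - u) -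
    chirpPhase R ρ t s₀) (θ₁ := fun u => -chirpPhaseDeriv R ρ t (s₀ - u))
    (θ₂ := fun u => chirpPhaseDeriv₂ R ρ t (s₀ - u)) (by simp) (by simpa using hs) ?_ ?_ ?_ ?_
  all_goals
    intro u hu
    have hu1 := hu.1
  · exact hasDerivAt_chirpPhase_left (by linarith)
  · exact hasDerivAt_chirpPhaseDeriv_left (by linarith)
  · exact (chirpPhaseDeriv₂_bounds hρ0 hρ ht (by linarith)).1
  · linarith [(chirpPhaseDeriv₂_bounds hρ0 hρ ht (by linarith : s₀ - u ≤ 1)).2]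

/-- Moving left from `s₀`, the amplitude decreases while `θ'` increases, so `w/θ'` decreases all the
way to `0` and no lower bound on `s₀` is needed. -/
theorem integral_sin_left_nonneg (n : ℕ) (hR : 0 < R) (hρ0 : 0 ≤ ρ) (hρ : ρ ≤ 2 * R)
    (ht : 2 ≤ t) (h0 : 0 < s₀) (h1 : s₀ ≤ 1) (hs : chirpPhaseDeriv R ρ t s₀ = 0) :
    0 ≤ ∫ s in (0 : ℝ)..s₀,
      Real.sin (chirpPhase R ρ t s - chirpPhase R ρ t s₀) * kernelAmp n t s := by
  have hb := chirpPhase_left_bounds hρ0 hρ ht h1 hs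
  -- Only the sign is wanted, so the interval `[p, q]` degenerates to a point and `m = 0`.
  have key := mul_sub_le_integral_sin_mul (d := s₀) (p := s₀) (q := s₀) (m := 0) (R := R) h0 le_rfl
    le_rfl hR (θ := fun u => chirpPhase R ρ t (s₀ - u) - chirpPhase R ρ t s₀)
    (θ₁ := fun u => -chirpPhaseDeriv R ρ t (s₀ - u))
    (θ₂ := fun u => chirpPhaseDeriv₂ R ρ t (s₀ - u))
    (w := fun u => kernelAmp n t (s₀ - u)) (w₁ := fun u => -kernelAmpDeriv n t (s₀ - u))
    (fun u hu => hasDerivAt_chirpPhase_left (by linarith [hu.1]))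
    (fun u hu => hasDerivAt_chirpPhaseDeriv_left (by linarith [hu.1]))
    (fun u hu => (hb u hu).1) (fun u hu => (hb u hu).2.2.2)
    (fun u hu => le_trans (by positivity) (hb u hu).2.2.1)
    (fun u hu => (hasDerivAt_kernelAmp (by linarith [hu.1])).comp_const_sub s₀ u)
    (fun u hu => (kernelAmp_pos (by linarith [hu.1])).le)
    (fun u hu => kernelAmp_le_one (by linarith [hu.1])) ?_ ?_
  · have e := intervalIntegral.integral_comp_sub_left (a := 0) (b := s₀) (fun s =>
      Real.sin (chirpPhase R ρ t s - chirpPhase R ρ t s₀) * kernelAmp n t s) s₀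
    rw [sub_self, sub_zero] at e
    rw [← e]
    simpa using key
  all_goals
    have hdec : ∀ u ∈ Set.Icc 0 s₀, -kernelAmpDeriv n t (s₀ - u) * -chirpPhaseDeriv R ρ t (s₀ - u)
        ≤ kernelAmp n t (s₀ - u) * chirpPhaseDeriv₂ R ρ t (s₀ - u) := by
      intro u hu
      have hu1 := hu.1
      have a1 : 0 < t - (s₀ - u) := by linarith
      have a2 := (kernelAmp_pos (n := n) a1).le
      have a3 := kernelAmpDeriv_nonneg (n := n) a1
      have a4 := (chirpPhaseDeriv₂_bounds hρ0 hρ ht (by linarith : s₀ - u ≤ 1)).1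
      have a5 : 0 ≤ -chirpPhaseDeriv R ρ t (s₀ - u) := le_trans (by positivity) (hb u hu).1
      have a6 : 0 ≤ chirpPhaseDeriv₂ R ρ t (s₀ - u) := le_trans (by positivity) a4
      exact (mul_nonpos_of_nonpos_of_nonneg (neg_nonpos.2 a3) a5).trans (mul_nonneg a2 a6)
  · exact hdec
  · intro u hu
    have hu' : u ∈ Set.Icc 0 s₀ := ⟨h0.le.trans hu.1, hu.2⟩
    exact div_nonneg (mul_nonneg (by linarith [Real.cos_le_one (chirpPhase R ρ t (s₀ - u) -
      chirpPhase R ρ t s₀)]) (sub_nonneg.2 (hdec u hu'))) (sq_nonneg _)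

theorem one_div_le_one_sub_cos {x : ℝ} (h1 : 1 / 4 ≤ x) (h2 : x ≤ 2) :
    1 / 80 ≤ 1 - Real.cos x := by
  have hpi := Real.pi_gt_three
  have hpi2 : Real.pi ^ 2 ≤ 10 := by nlinarith [Real.pi_lt_d2]
  have h := Real.cos_le_one_sub_mul_cos_sq (x := x) (abs_le.2 ⟨by linarith, by linarith⟩)
  have h3 : 1 / 5 ≤ 2 / Real.pi ^ 2 := by
    rw [div_le_div_iff₀ (by norm_num) (by positivity)]
    linarith
  nlinarith

/-- To the right the amplitude grows, which competes with the growth of `θ'`; near `s₀` the latter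
wins, and the scale `u ~ 1/R` alone already contributes a multiple of `1/R`. -/
theorem le_integral_sin_right {n : ℕ} (hn : 1 ≤ n) (hR : 2 * n ≤ R) (hρ0 : 0 ≤ ρ)
    (hρ : ρ ≤ 2 * R) (ht : 2 ≤ t) (ht3 : t ≤ 3) (h0 : 0 ≤ s₀) (h1 : s₀ + 1 / (2 * n) ≤ 1)
    (hs : chirpPhaseDeriv R ρ t s₀ = 0) :
    ((3 : ℝ) ^ ((n : ℝ) / 2))⁻¹ / 2560 / R ≤ ∫ s in s₀..(s₀ + 1 / (2 * n)),
      Real.sin (chirpPhase R ρ t s - chirpPhase R ρ t s₀) * kernelAmp n t s := by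
  have hn' : (1 : ℝ) ≤ n := by exact_mod_cast hn
  have hR0 : 0 < R := by linarith
  set A : ℝ := ((3 : ℝ) ^ ((n : ℝ) / 2))⁻¹ with hA
  have hA0 : 0 < A := by positivity
  -- With `w₁ ≤ (n/2) w`, `θ₁ ≤ 4R²u` and `θ₂ ≥ 2R²`, the condition `n * u ≤ 1/2` makes `w₁ θ₁` at
  -- most half of `w θ₂`, which leaves a definite surplus.
  set d : ℝ := 1 / (2 * n) with hd
  have hd0 : 0 < d := by positivity
  have hsub : ∀ u ∈ Set.Icc 0 d, u ∈ Set.Icc 0 (1 - s₀) := fun u hu =>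
    ⟨hu.1, by linarith [hu.2]⟩
  have hb := fun u hu => chirpPhase_right_bounds hρ0 hρ ht hs u (hsub u hu)
  have hhalf : ∀ u ∈ Set.Icc 0 d, kernelAmpDeriv n t (s₀ + u) * chirpPhaseDeriv R ρ t (s₀ + u)
      ≤ kernelAmp n t (s₀ + u) * chirpPhaseDeriv₂ R ρ t (s₀ + u) / 2 := by
    intro u hu
    have hu2 := hu.2
    have a1 : 1 ≤ t - (s₀ + u) := by linarith
    have a2 := (kernelAmp_pos (n := n) (zero_lt_one.trans_le a1)).le
    have a3 := kernelAmpDeriv_le (n := n) a1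
    have a4 := (chirpPhaseDeriv₂_bounds hρ0 hρ ht (by linarith : s₀ + u ≤ 1)).1
    have a5 : 0 ≤ chirpPhaseDeriv R ρ t (s₀ + u) :=
      le_trans (mul_nonneg (by positivity) hu.1) (hb u hu).1
    have a6 := (hb u hu).2.1
    have a7 : n * u ≤ 1 / 2 := by
      calc n * u ≤ n * d := by gcongr
        _ = 1 / 2 := by rw [hd]; field_simp
    calc _ ≤ n / 2 * kernelAmp n t (s₀ + u) * (2 * (2 * R ^ 2) * u) :=
          mul_le_mul a3 a6 a5 (by positivity)
      _ = kernelAmp n t (s₀ + u) * (2 * R ^ 2) * (n * u) := by ring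
      _ ≤ kernelAmp n t (s₀ + u) * (2 * R ^ 2) * (1 / 2) := by gcongr
      _ ≤ kernelAmp n t (s₀ + u) * chirpPhaseDeriv₂ R ρ t (s₀ + u) * (1 / 2) := by gcongr
      _ = _ := by ring
  have hθ2 : ∀ u ∈ Set.Icc 0 d, 2 * R ^ 2 ≤ chirpPhaseDeriv₂ R ρ t (s₀ + u) := fun u hu =>
    (chirpPhaseDeriv₂_bounds hρ0 hρ ht (by linarith [hu.2] : s₀ + u ≤ 1)).1
  have hqd : 1 / R ≤ d := one_div_le_one_div_of_le (by positivity) hR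
  -- On `[1/(2R), 1/R]` the phase lies in `[1/4, 2]`, so `1 - cos θ ≥ 1/80`; the surplus is at least
  -- `A R²` and `θ₁² ≤ 16R²`. This gives `m = A/1280`, on an interval of length `1/(2R)`.
  have key := mul_sub_le_integral_sin_mul (d := d) (p := 1 / (2 * R)) (q := 1 / R)
    (m := A / 1280) (R := R) (by positivity) (one_div_le_one_div_of_le hR0 (by linarith))
    hqd hR0
    (θ := fun u => chirpPhase R ρ t (s₀ + u) - chirpPhase R ρ t s₀)
    (θ₁ := fun u => chirpPhaseDeriv R ρ t (s₀ + u))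
    (θ₂ := fun u => chirpPhaseDeriv₂ R ρ t (s₀ + u))
    (w := fun u => kernelAmp n t (s₀ + u)) (w₁ := fun u => kernelAmpDeriv n t (s₀ + u))
    (fun u hu => ((hasDerivAt_chirpPhase (by linarith [hu.2])).comp_const_add s₀ u).sub_const _)
    (fun u hu => (hasDerivAt_chirpPhaseDeriv (by linarith [hu.2])).comp_const_add s₀ u)
    (fun u hu => (hb u hu).1) (fun u hu => (hb u hu).2.2.2)
    (fun u hu => le_trans (by positivity) (hb u hu).2.2.1)
    (fun u hu => (hasDerivAt_kernelAmp (by linarith [hu.2])).comp_const_add s₀ u)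
    (fun u hu => (kernelAmp_pos (by linarith [hu.2])).le)
    (fun u hu => kernelAmp_le_one (by linarith [hu.2])) ?_ ?_
  · have e := intervalIntegral.integral_comp_add_left (a := 0) (b := d) (fun s =>
      Real.sin (chirpPhase R ρ t s - chirpPhase R ρ t s₀) * kernelAmp n t s) s₀
    rw [add_zero] at e
    rw [← e]
    refine le_trans (le_of_eq ?_) key
    field_simp
    ring
  · intro u hu
    have a1 : 0 ≤ kernelAmp n t (s₀ + u) := (kernelAmp_pos (by linarith [hu.2])).le
    have a2 : 0 ≤ kernelAmp n t (s₀ + u) * chirpPhaseDeriv₂ R ρ t (s₀ + u) :=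
      mul_nonneg a1 (le_trans (by positivity) (hθ2 u hu))
    linarith [hhalf u hu]
  · intro u hu
    have hu0 : 0 < u := lt_of_lt_of_le (by positivity) hu.1
    have hu' : u ∈ Set.Icc 0 d := ⟨hu0.le, hu.2.trans hqd⟩
    have v1 : 1 / 2 ≤ R * u := by
      have := mul_le_mul_of_nonneg_left hu.1 hR0.le
      refine le_trans (le_of_eq ?_) this
      field_simp
    have v2 : R * u ≤ 1 := by
      have := mul_le_mul_of_nonneg_left hu.2 hR0.le
      refine this.trans (le_of_eq ?_)
      field_simp
    obtain ⟨b1, b2, b3, b4⟩ := hb u hu'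
    have hpos1 : 0 < chirpPhaseDeriv R ρ t (s₀ + u) := lt_of_lt_of_le (by positivity) b1
    rw [le_div_iff₀ (by positivity)]
    have c1 : 1 / 80 ≤ 1 - Real.cos (chirpPhase R ρ t (s₀ + u) - chirpPhase R ρ t s₀) :=
      one_div_le_one_sub_cos (by nlinarith) (by nlinarith)
    have c2 : A ≤ kernelAmp n t (s₀ + u) := le_kernelAmp (by linarith [hu'.2]) (by linarith)
    have c3 : A * R ^ 2 ≤ kernelAmp n t (s₀ + u) * chirpPhaseDeriv₂ R ρ t (s₀ + u) -
        kernelAmpDeriv n t (s₀ + u) * chirpPhaseDeriv R ρ t (s₀ + u) := by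
      have d1 := hhalf u hu'
      have d2 : A * (2 * R ^ 2) ≤ kernelAmp n t (s₀ + u) * chirpPhaseDeriv₂ R ρ t (s₀ + u) :=
        mul_le_mul c2 (hθ2 u hu') (by positivity) (hA0.le.trans c2)
      linarith
    have c4 : chirpPhaseDeriv R ρ t (s₀ + u) ^ 2 ≤ 16 * R ^ 2 := by
      calc _ ≤ (2 * (2 * R ^ 2) * u) ^ 2 := pow_le_pow_left₀ hpos1.le b2 2
        _ = 16 * R ^ 2 * (R * u) ^ 2 := by ring
        _ ≤ 16 * R ^ 2 * 1 := by gcongr; exact pow_le_one₀ (by positivity) v2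
        _ = _ := by ring
    calc A / 1280 * chirpPhaseDeriv R ρ t (s₀ + u) ^ 2 ≤ A / 1280 * (16 * R ^ 2) := by gcongr
      _ = 1 / 80 * (A * R ^ 2) := by ring
      _ ≤ _ := mul_le_mul c1 c3 (by positivity) (by linarith)

end CriticalPoint

/-! ### Size of the oscillatory integral and its stability in `ρ` -/

open Complex in
theorem norm_exp_I_mul_ofReal' (x : ℝ) : ‖cexp (I * x)‖ = 1 := by
  rw [mul_comm]; exact norm_exp_ofReal_mul_I _

section
variable {R ρ t : ℝ}

open Complex in
theorem continuousOn_exp_chirpPhase (ht : 2 ≤ t) :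
    ContinuousOn (fun s => cexp (I * chirpPhase R ρ t s)) (Set.Icc 0 1) := by
  have : ContinuousOn (chirpPhase R ρ t) (Set.Icc 0 1) := fun s hs =>
    (hasDerivAt_chirpPhase (by linarith [hs.2])).continuousAt.continuousWithinAt
  have := continuous_ofReal.comp_continuousOn this
  have h2 : ContinuousOn (fun s => (chirpPhase R ρ t s : ℂ)) (Set.Icc 0 1) := this
  fun_prop

open Complex in
theorem norm_integral_exp_chirpPhase_mul_le_of_le_abs_deriv {a b μ M : ℝ} {ψ ψ₁ : ℝ → ℂ}
    (hρ0 : 0 ≤ ρ) (hρ : ρ ≤ 2 * R) (ht : 2 ≤ t) (ha : 0 ≤ a) (hab : a ≤ b) (hb : b ≤ 1)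
    (hμ : 0 < μ) (hlow : ∀ s ∈ Set.Icc a b, μ ≤ |chirpPhaseDeriv R ρ t s|)
    (hψ : ∀ s ∈ Set.Icc (0 : ℝ) 1, HasDerivAt ψ (ψ₁ s) s)
    (hψ₁ : ContinuousOn ψ₁ (Set.Icc 0 1))
    (hM : ∀ s ∈ Set.Icc (0 : ℝ) 1, ‖ψ s‖ ≤ M) (hM₁ : ∀ s ∈ Set.Icc (0 : ℝ) 1, ‖ψ₁ s‖ ≤ M) :
    ‖∫ s in a..b, cexp (I * chirpPhase R ρ t s) * ψ s‖ ≤ 5 * M / μ := by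
  have hsub : Set.Icc a b ⊆ Set.Icc 0 1 := Set.Icc_subset_Icc ha hb
  exact norm_integral_exp_mul_le_of_le_abs_deriv hab (by linarith) hμ
    (fun s hs => hasDerivAt_chirpPhase (by linarith [hs.2]))
    (fun s hs => hasDerivAt_chirpPhaseDeriv (by linarith [hs.2]))
    ((continuousOn_chirpPhaseDeriv₂ ht).mono hsub)
    (fun s hs => le_trans (by positivity)
      (chirpPhaseDeriv₂_bounds hρ0 hρ ht (by linarith [hs.2])).1)
    hlow (fun s hs => hψ s (hsub hs)) (hψ₁.mono hsub) (fun s hs => hM s (hsub hs))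
    (fun s hs => hM₁ s (hsub hs))

open Complex in
/-- Second-derivative test for the chirp phase. -/
theorem norm_integral_exp_chirpPhase_mul_le {M : ℝ} {ψ ψ₁ : ℝ → ℂ} (hR : 4 ≤ R)
    (hρ0 : 0 < ρ) (hρ : ρ ≤ 2 * R) (ht : 2 ≤ t)
    (hψ : ∀ s ∈ Set.Icc (0 : ℝ) 1, HasDerivAt ψ (ψ₁ s) s)
    (hψ₁ : ContinuousOn ψ₁ (Set.Icc 0 1))
    (hM : ∀ s ∈ Set.Icc (0 : ℝ) 1, ‖ψ s‖ ≤ M) (hM₁ : ∀ s ∈ Set.Icc (0 : ℝ) 1, ‖ψ₁ s‖ ≤ M) :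
    ‖∫ s in (0 : ℝ)..1, cexp (I * chirpPhase R ρ t s) * ψ s‖ ≤ 7 * M / R := by
  have hR0 : 0 < R := by linarith
  have hM0 : 0 ≤ M := (norm_nonneg _).trans (hM 0 ⟨le_rfl, zero_le_one⟩)
  obtain ⟨s₀, ⟨h0, h4⟩, hs⟩ := exists_chirpPhaseDeriv_eq_zero hR0 hρ0 hρ ht
  have hRi : 1 / R ≤ 1 / 4 := one_div_le_one_div_of_le (by norm_num) hR
  have hRp : 0 < 1 / R := by positivity
  -- The critical point may be closer than `1/R` to `0`, in which case the left piece is empty. The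
  -- middle piece costs its length `2/R`, and each outer one has `|φ'| ≥ 2R`: `2 + 5/2 + 5/2 = 7`.
  set a : ℝ := max 0 (s₀ - 1 / R) with ha
  set b : ℝ := s₀ + 1 / R with hb
  have ha0 : 0 ≤ a := le_max_left _ _
  have has : a ≤ s₀ := max_le h0.le (by linarith)
  have hai : s₀ - 1 / R ≤ a := le_max_right _ _
  have hb1 : b ≤ 1 := by linarith
  have hab : a ≤ b := by linarith
  have cf : ContinuousOn (fun s => cexp (I * chirpPhase R ρ t s) * ψ s) (Set.Icc 0 1) :=
    (continuousOn_exp_chirpPhase ht).mul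
      fun s hs => (hψ s hs).continuousAt.continuousWithinAt
  have ii : ∀ x ∈ Set.Icc (0 : ℝ) 1, ∀ y ∈ Set.Icc (0 : ℝ) 1, IntervalIntegrable
      (fun s => cexp (I * chirpPhase R ρ t s) * ψ s) volume x y := fun x hx y hy =>
    (cf.mono (Set.uIcc_subset_Icc hx hy)).intervalIntegrable
  have I0 : (0 : ℝ) ∈ Set.Icc (0 : ℝ) 1 := ⟨le_rfl, zero_le_one⟩
  have I1 : (1 : ℝ) ∈ Set.Icc (0 : ℝ) 1 := ⟨zero_le_one, le_rfl⟩
  have Ia : a ∈ Set.Icc (0 : ℝ) 1 := ⟨ha0, by linarith⟩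
  have Ib : b ∈ Set.Icc (0 : ℝ) 1 := ⟨by linarith, hb1⟩
  have mid : ‖∫ s in a..b, cexp (I * chirpPhase R ρ t s) * ψ s‖ ≤ 2 * M / R := by
    have := intervalIntegral.norm_integral_le_of_norm_le_const (a := a) (b := b) (C := M)
      (f := fun s => cexp (I * chirpPhase R ρ t s) * ψ s) fun s hs => by
        rw [Set.uIoc_of_le hab] at hs
        rw [norm_mul, norm_exp_I_mul_ofReal', one_mul]
        exact hM s ⟨by linarith [hs.1], by linarith [hs.2]⟩
    refine this.trans ?_
    rw [abs_of_nonneg (by linarith)]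
    calc M * (b - a) ≤ M * (2 * (1 / R)) := by gcongr; linarith
      _ = _ := by ring
  have eR : 5 * M / (2 * R) = 5 / 2 * M / R := by field_simp
  have right : ‖∫ s in b..1, cexp (I * chirpPhase R ρ t s) * ψ s‖ ≤ 5 / 2 * M / R := by
    rw [← eR]
    refine norm_integral_exp_chirpPhase_mul_le_of_le_abs_deriv hρ0.le hρ ht Ib.1 hb1 le_rfl
      (by positivity) (fun s hs' => ?_) hψ hψ₁ hM hM₁
    have := (chirpPhase_right_bounds hρ0.le hρ ht hs (s - s₀)
      ⟨by linarith [hs'.1], by linarith [hs'.2]⟩).1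
    rw [add_sub_cancel] at this
    refine le_trans ?_ (this.trans (le_abs_self _))
    have h3 : 1 / R ≤ s - s₀ := by linarith [hs'.1]
    calc 2 * R = 2 * R ^ 2 * (1 / R) := by field_simp
      _ ≤ _ := by gcongr
  have left : ‖∫ s in (0 : ℝ)..a, cexp (I * chirpPhase R ρ t s) * ψ s‖ ≤ 5 / 2 * M / R := by
    rcases ha0.eq_or_lt with h | h
    · rw [← h]; simp only [intervalIntegral.integral_same, norm_zero]; positivity
    have hae : a = s₀ - 1 / R := by
      rcases max_choice 0 (s₀ - 1 / R) with h' | h'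
      · rw [← ha] at h'; linarith
      · exact h'
    rw [← eR]
    refine norm_integral_exp_chirpPhase_mul_le_of_le_abs_deriv hρ0.le hρ ht le_rfl ha0 Ia.2
      (by positivity) (fun s hs' => ?_) hψ hψ₁ hM hM₁
    have := (chirpPhase_left_bounds hρ0.le hρ ht (by linarith) hs (s₀ - s)
      ⟨by linarith [hs'.2], by linarith [hs'.1]⟩).1
    rw [sub_sub_cancel] at this
    refine le_trans ?_ (this.trans (neg_le_abs _))
    have h3 : 1 / R ≤ s₀ - s := by linarith [hs'.2]
    calc 2 * R = 2 * R ^ 2 * (1 / R) := by field_simp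
      _ ≤ _ := by gcongr
  rw [← intervalIntegral.integral_add_adjacent_intervals (ii 0 I0 a Ia) (ii a Ia 1 I1),
    ← intervalIntegral.integral_add_adjacent_intervals (ii a Ia b Ib) (ii b Ib 1 I1)]
  calc _ ≤ 5 / 2 * M / R + (2 * M / R + 5 / 2 * M / R) :=
        (norm_add_le _ _).trans (add_le_add left ((norm_add_le _ _).trans (add_le_add mid right)))
    _ = _ := by ring

theorem continuousOn_kernelAmp {n : ℕ} (ht : 2 ≤ t) :
    ContinuousOn (kernelAmp n t) (Set.Icc 0 1) := fun s hs =>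
  (hasDerivAt_kernelAmp (by linarith [hs.2])).continuousAt.continuousWithinAt

open Complex in
/-- Lower bound for the oscillatory integral at the centre of the ball. -/
theorem le_norm_integral_exp_chirpPhase {n : ℕ} (hn : 1 ≤ n)
    (hR : 25600 * (n : ℝ) ^ 2 * (3 : ℝ) ^ ((n : ℝ) / 2) ≤ R) (hρ0 : 0 < ρ) (hρ : ρ ≤ 2 * R)
    (ht : 2 ≤ t) (ht3 : t ≤ 3) :
    ((3 : ℝ) ^ ((n : ℝ) / 2))⁻¹ / 5120 / R ≤
      ‖∫ s in (0 : ℝ)..1, cexp (I * chirpPhase R ρ t s) * kernelAmp n t s‖ := by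
  have hn' : (1 : ℝ) ≤ n := by exact_mod_cast hn
  set B : ℝ := (3 : ℝ) ^ ((n : ℝ) / 2) with hB
  have hB1 : 1 ≤ B := Real.one_le_rpow (by norm_num) (by positivity)
  have hR1 : 25600 * (n : ℝ) ≤ R := by
    refine le_trans ?_ hR
    have : (n : ℝ) * 1 ≤ n * n := by gcongr
    nlinarith [mul_nonneg (by positivity : 0 ≤ (n : ℝ) ^ 2) (sub_nonneg.2 hB1)]
  have hR0 : 0 < R := by linarith
  obtain ⟨s₀, ⟨h0, h4⟩, hs⟩ := exists_chirpPhaseDeriv_eq_zero hR0 hρ0 hρ ht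
  set d : ℝ := 1 / (2 * n) with hd
  have hd0 : 0 < d := by positivity
  have hd1 : d ≤ 1 / 2 := one_div_le_one_div_of_le (by norm_num) (by linarith)
  set b : ℝ := s₀ + d with hb
  have hb1 : b ≤ 1 := by linarith
  have cf : ContinuousOn (fun s => cexp (I * chirpPhase R ρ t s) * kernelAmp n t s)
      (Set.Icc 0 1) :=
    (continuousOn_exp_chirpPhase ht).mul
      (continuous_ofReal.comp_continuousOn (continuousOn_kernelAmp ht))
  have ii : ∀ x ∈ Set.Icc (0 : ℝ) 1, ∀ y ∈ Set.Icc (0 : ℝ) 1, IntervalIntegrable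
      (fun s => cexp (I * chirpPhase R ρ t s) * kernelAmp n t s) volume x y := fun x hx y hy =>
    (cf.mono (Set.uIcc_subset_Icc hx hy)).intervalIntegrable
  have I0 : (0 : ℝ) ∈ Set.Icc (0 : ℝ) 1 := ⟨le_rfl, zero_le_one⟩
  have I1 : (1 : ℝ) ∈ Set.Icc (0 : ℝ) 1 := ⟨zero_le_one, le_rfl⟩
  have Is : s₀ ∈ Set.Icc (0 : ℝ) 1 := ⟨h0.le, by linarith⟩
  have Ib : b ∈ Set.Icc (0 : ℝ) 1 := ⟨by linarith, hb1⟩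
  -- Beyond `b` monotonicity of `w/θ'` is not guaranteed, but `φ' ≥ R²/n`, so the piece is at most
  -- `5n²/R²`. The factor `25600 = 5 · 5120` in the threshold on `R` makes this half of the bound
  -- for `head`.
  have tail : ‖∫ s in b..1, cexp (I * chirpPhase R ρ t s) * kernelAmp n t s‖ ≤
      B⁻¹ / 5120 / R := by
    have h1 : ‖∫ s in b..1, cexp (I * chirpPhase R ρ t s) * kernelAmp n t s‖ ≤
        5 * n / (R ^ 2 / n) := by
      refine norm_integral_exp_chirpPhase_mul_le_of_le_abs_deriv (ψ := fun s => kernelAmp n t s)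
        (ψ₁ := fun s => kernelAmpDeriv n t s) hρ0.le hρ ht Ib.1 hb1 le_rfl
        (by positivity) (fun s hs' => ?_)
        (fun s hs' => (hasDerivAt_kernelAmp (by linarith [hs'.2])).ofReal_comp)
        (continuous_ofReal.comp_continuousOn (continuousOn_kernelAmpDeriv ht)) ?_ ?_
      · have := (chirpPhase_right_bounds hρ0.le hρ ht hs (s - s₀)
          ⟨by linarith [hs'.1], by linarith [hs'.2]⟩).1
        rw [add_sub_cancel] at this
        refine le_trans ?_ (this.trans (le_abs_self _))
        have h3 : d ≤ s - s₀ := by linarith [hs'.1]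
        calc R ^ 2 / n = 2 * R ^ 2 * d := by rw [hd]; field_simp
          _ ≤ _ := by gcongr
      · intro s hs'
        have h1 : 1 ≤ t - s := by linarith [hs'.2]
        rw [norm_real, Real.norm_of_nonneg (kernelAmp_pos (by linarith)).le]
        exact (kernelAmp_le_one h1).trans hn'
      · intro s hs'
        have h1 : 1 ≤ t - s := by linarith [hs'.2]
        rw [norm_real, Real.norm_of_nonneg (kernelAmpDeriv_nonneg (by linarith))]
        refine (kernelAmpDeriv_le h1).trans ?_
        nlinarith [kernelAmp_le_one (n := n) h1]
    refine h1.trans ?_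
    rw [div_div, inv_eq_one_div, div_div, div_div_eq_mul_div, div_le_div_iff₀ (by positivity)
      (by positivity)]
    have := mul_le_mul_of_nonneg_right hR hR0.le
    nlinarith
  have head : B⁻¹ / 2560 / R ≤ ‖∫ s in (0 : ℝ)..b,
      cexp (I * chirpPhase R ρ t s) * kernelAmp n t s‖ := by
    have hl := integral_sin_left_nonneg n hR0 hρ0.le hρ ht h0 Is.2 hs
    have hr := le_integral_sin_right hn (by linarith) hρ0.le hρ ht ht3 h0.le hb1 hs
    have cs : ContinuousOn (fun s => Real.sin (chirpPhase R ρ t s - chirpPhase R ρ t s₀) *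
        kernelAmp n t s) (Set.Icc 0 1) := by
      have : ContinuousOn (chirpPhase R ρ t) (Set.Icc 0 1) := fun s hs =>
        (hasDerivAt_chirpPhase (by linarith [hs.2])).continuousAt.continuousWithinAt
      exact (Real.continuous_sin.comp_continuousOn (this.sub continuousOn_const)).mul
        (continuousOn_kernelAmp ht)
    have hsum := intervalIntegral.integral_add_adjacent_intervals
      (cs.mono (Set.uIcc_subset_Icc I0 Is)).intervalIntegrable (μ := volume)
      (cs.mono (Set.uIcc_subset_Icc Is Ib)).intervalIntegrable
    -- Rotating by the phase at `s₀` does not change the modulus and turns the imaginary part into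
    -- the sine integral bounded on both sides of `s₀`.
    have him : ((cexp (-(I * chirpPhase R ρ t s₀)) * ∫ s in (0 : ℝ)..b,
        cexp (I * chirpPhase R ρ t s) * kernelAmp n t s)).im =
        ∫ s in (0 : ℝ)..b, Real.sin (chirpPhase R ρ t s - chirpPhase R ρ t s₀) *
          kernelAmp n t s := by
      rw [← intervalIntegral.integral_const_mul]
      have := Complex.imCLM.intervalIntegral_comp_comm
        ((ii 0 I0 b Ib).const_mul (cexp (-(I * chirpPhase R ρ t s₀))))
      rw [← Complex.imCLM_apply, ← this]
      refine intervalIntegral.integral_congr fun s _ => ?_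
      have e : cexp (-(I * chirpPhase R ρ t s₀)) *
          (cexp (I * chirpPhase R ρ t s) * kernelAmp n t s) =
          cexp (((chirpPhase R ρ t s - chirpPhase R ρ t s₀ : ℝ) : ℂ) * I) * kernelAmp n t s := by
        rw [← mul_assoc, ← Complex.exp_add]
        congr 2
        push_cast; ring
      simp only [Complex.imCLM_apply]
      rw [e, Complex.im_mul_ofReal, Complex.exp_ofReal_mul_I_im]
    have hnorm : ‖cexp (-(I * chirpPhase R ρ t s₀))‖ = 1 := by
      have := norm_exp_I_mul_ofReal' (-chirpPhase R ρ t s₀)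
      rwa [ofReal_neg, mul_neg] at this
    calc B⁻¹ / 2560 / R ≤ _ := by linarith
      _ = _ := hsum
      _ = _ := him.symm
      _ ≤ _ := (le_abs_self _).trans (Complex.abs_im_le_norm _)
      _ = _ := by rw [norm_mul, hnorm, one_mul]
  rw [← intervalIntegral.integral_add_adjacent_intervals (ii 0 I0 b Ib) (ii b Ib 1 I1)]
  have h5 : B⁻¹ / 5120 / R = B⁻¹ / 2560 / R - B⁻¹ / 5120 / R := by ring
  rw [h5]
  have := norm_sub_le_norm_add (∫ s in (0 : ℝ)..b, cexp (I * chirpPhase R ρ t s) * kernelAmp n t s)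
    (∫ s in b..1, cexp (I * chirpPhase R ρ t s) * kernelAmp n t s)
  linarith

end

open Complex in
/-- Moving the singularity by `O(η / R)` changes the oscillatory integral by `O(η / R)`. -/
theorem norm_integral_exp_chirpPhase_sub_le {n : ℕ} (hn : 1 ≤ n) {R ρ ρ' t η : ℝ} (hR : 4 ≤ R)
    (hρ0 : 0 < ρ) (hρ : ρ ≤ 2 * R) (ht : 2 ≤ t) (hD : |ρ ^ 2 - ρ' ^ 2| ≤ 5 * η) :
    ‖(∫ s in (0 : ℝ)..1, cexp (I * chirpPhase R ρ' t s) * kernelAmp n t s) -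
      ∫ s in (0 : ℝ)..1, cexp (I * chirpPhase R ρ t s) * kernelAmp n t s‖ ≤ 35 * n * η / R := by
  have hn' : (1 : ℝ) ≤ n := by exact_mod_cast hn
  set D : ℝ := ρ ^ 2 - ρ' ^ 2 with hDdef
  have hη : 0 ≤ η := by linarith [abs_nonneg D]
  have ii : ∀ r : ℝ, IntervalIntegrable
      (fun s => cexp (I * chirpPhase R r t s) * kernelAmp n t s) volume 0 1 := fun r => by
    refine ContinuousOn.intervalIntegrable ?_
    rw [Set.uIcc_of_le zero_le_one]
    exact (continuousOn_exp_chirpPhase ht).mul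
      (continuous_ofReal.comp_continuousOn (continuousOn_kernelAmp ht))
  rw [← intervalIntegral.integral_sub (ii _) (ii _)]
  -- The two phases differ by `D/(4(t-s))`, which does not grow with `R`. The difference keeps the
  -- phase of `ρ` and has an amplitude that is `O(η)` together with its derivative, so the
  -- second-derivative test still gains `1/R`.
  set ψ : ℝ → ℂ := fun s => kernelAmp n t s * (cexp (I * ((D / (4 * (t - s)) : ℝ) : ℂ)) - 1)
    with hψ
  set ψ₁ : ℝ → ℂ := fun s => kernelAmpDeriv n t s * (cexp (I * ((D / (4 * (t - s)) : ℝ) : ℂ)) - 1)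
    + kernelAmp n t s * (cexp (I * ((D / (4 * (t - s)) : ℝ) : ℂ)) *
      (I * ((D / (4 * (t - s) ^ 2) : ℝ) : ℂ))) with hψ₁
  have e : ∀ s, cexp (I * chirpPhase R ρ' t s) * kernelAmp n t s -
      cexp (I * chirpPhase R ρ t s) * kernelAmp n t s = cexp (I * chirpPhase R ρ t s) * ψ s := by
    intro s
    have h : chirpPhase R ρ' t s = chirpPhase R ρ t s + D / (4 * (t - s)) := by
      simp only [chirpPhase, hDdef]; ring
    simp only [hψ]
    rw [h, ofReal_add, mul_add, Complex.exp_add]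
    ring
  simp only [e]
  have hq : ∀ s ∈ Set.Icc (0 : ℝ) 1,
      HasDerivAt (fun s => D / (4 * (t - s))) (D / (4 * (t - s) ^ 2)) s := by
    intro s hs
    have h0 : 0 < t - s := by linarith [hs.2]
    have h1 : HasDerivAt (fun s => 4 * (t - s)) (4 * (-1)) s :=
      ((hasDerivAt_id s).const_sub t).const_mul 4
    refine ((hasDerivAt_const s D).div h1 (by positivity)).congr_deriv ?_
    field_simp
    ring
  have hb : ∀ s ∈ Set.Icc (0 : ℝ) 1, ‖cexp (I * ((D / (4 * (t - s)) : ℝ) : ℂ)) - 1‖ ≤ 5 / 4 * η := by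
    intro s hs
    have h0 : 1 ≤ t - s := by linarith [hs.2]
    refine (Real.norm_exp_I_mul_ofReal_sub_one_le).trans ?_
    rw [Real.norm_eq_abs, abs_div, abs_of_pos (by positivity : 0 < 4 * (t - s)),
      div_le_iff₀ (by positivity)]
    nlinarith
  have hb2 : ∀ s ∈ Set.Icc (0 : ℝ) 1, |D / (4 * (t - s) ^ 2)| ≤ 5 / 4 * η := by
    intro s hs
    have h0 : 1 ≤ (t - s) ^ 2 := one_le_pow₀ (by linarith [hs.2])
    rw [abs_div, abs_of_pos (by positivity : 0 < 4 * (t - s) ^ 2), div_le_iff₀ (by positivity)]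
    nlinarith
  have hA : ∀ s ∈ Set.Icc (0 : ℝ) 1, ‖(kernelAmp n t s : ℂ)‖ ≤ 1 := fun s hs => by
    have h0 : 1 ≤ t - s := by linarith [hs.2]
    rw [norm_real, Real.norm_of_nonneg (kernelAmp_pos (by linarith)).le]
    exact kernelAmp_le_one h0
  have hA1 : ∀ s ∈ Set.Icc (0 : ℝ) 1, ‖(kernelAmpDeriv n t s : ℂ)‖ ≤ n / 2 := fun s hs => by
    have h0 : 1 ≤ t - s := by linarith [hs.2]
    rw [norm_real, Real.norm_of_nonneg (kernelAmpDeriv_nonneg (by linarith))]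
    exact (kernelAmpDeriv_le h0).trans (mul_le_of_le_one_right (by positivity)
      (kernelAmp_le_one h0))
  have key := norm_integral_exp_chirpPhase_mul_le (M := 5 * n * η) (ψ := ψ) (ψ₁ := ψ₁) hR hρ0 hρ ht
    ?_ ?_ ?_ ?_
  · exact key.trans (le_of_eq (by ring))
  · intro s hs
    exact (hasDerivAt_kernelAmp (by linarith [hs.2])).ofReal_comp.mul
      ((((hq s hs).ofReal_comp.const_mul I).cexp).sub_const 1)
  · have c0 : ContinuousOn (fun s => ((D / (4 * (t - s)) : ℝ) : ℂ)) (Set.Icc 0 1) := fun s hs =>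
      (hq s hs).ofReal_comp.continuousAt.continuousWithinAt
    have c1 : ContinuousOn (fun s => (kernelAmpDeriv n t s : ℂ)) (Set.Icc 0 1) :=
      continuous_ofReal.comp_continuousOn (continuousOn_kernelAmpDeriv ht)
    have c2 : ContinuousOn (fun s => (kernelAmp n t s : ℂ)) (Set.Icc 0 1) :=
      continuous_ofReal.comp_continuousOn (continuousOn_kernelAmp ht)
    have c3 : ContinuousOn (fun s => ((D / (4 * (t - s) ^ 2) : ℝ) : ℂ)) (Set.Icc 0 1) := by
      refine continuous_ofReal.comp_continuousOn (continuousOn_const.div (by fun_prop) fun s hs => ?_)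
      have : 0 < t - s := by linarith [hs.2]
      positivity
    simp only [hψ₁]
    fun_prop
  · intro s hs
    rw [hψ, norm_mul]
    calc _ ≤ 1 * (5 / 4 * η) := mul_le_mul (hA s hs) (hb s hs) (norm_nonneg _) zero_le_one
      _ ≤ 5 * n * η := by nlinarith
  · intro s hs
    simp only [hψ₁]
    refine (norm_add_le _ _).trans ?_
    rw [norm_mul, norm_mul, norm_mul, norm_exp_I_mul_ofReal', one_mul, norm_mul, norm_I, one_mul,
      norm_real (D / _), Real.norm_eq_abs (D / _)]
    calc _ ≤ (n : ℝ) / 2 * (5 / 4 * η) + 1 * (5 / 4 * η) :=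
          add_le_add (mul_le_mul (hA1 s hs) (hb s hs) (norm_nonneg _) (by positivity))
            (mul_le_mul (hA s hs) (hb2 s hs) (abs_nonneg _) zero_le_one)
      _ ≤ 5 * n * η := by nlinarith

/-! ### From the oscillatory integral to the solution -/

theorem testForcing_eq (n : ℕ) {R η : ℝ} (hR : 0 < R) (hη : 0 < η) (s : ℝ)
    (y : EuclideanSpace ℝ (Fin n)) :
    testForcing n R η s y = (Metric.ball (0 : EuclideanSpace ℝ (Fin n)) (η / R)).indicator
      (fun _ => Complex.exp (Complex.I * ((2 * R ^ 2 * s ^ 2 : ℝ) : ℂ))) y := by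
  have : (R / η) • y ∈ Metric.ball (0 : EuclideanSpace ℝ (Fin n)) 1 ↔
      y ∈ Metric.ball (0 : EuclideanSpace ℝ (Fin n)) (η / R) := by
    rw [mem_ball_zero_iff, mem_ball_zero_iff, norm_smul, Real.norm_of_nonneg (by positivity),
      lt_div_iff₀ hR, div_mul_eq_mul_div, div_lt_one hη, mul_comm]
  unfold testForcing
  by_cases h : y ∈ Metric.ball (0 : EuclideanSpace ℝ (Fin n)) (η / R)
  · rw [Set.indicator_of_mem (this.2 h), Set.indicator_of_mem h, mul_one]
  · rw [Set.indicator_of_notMem (fun h' => h (this.1 h')), Set.indicator_of_notMem h, mul_zero]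

theorem volume_real_ball (n : ℕ) (hn : 1 ≤ n) (x : EuclideanSpace ℝ (Fin n)) {r : ℝ} (hr : 0 < r) :
    volume.real (Metric.ball x r) =
      r ^ n * volume.real (Metric.ball (0 : EuclideanSpace ℝ (Fin n)) 1) := by
  have : Nonempty (Fin n) := ⟨⟨0, hn⟩⟩
  simp only [measureReal_def]
  rw [Measure.addHaar_ball_of_pos _ _ hr, ENNReal.toReal_mul, ENNReal.toReal_ofReal (by positivity)]
  simp

-- Fubini, with an integrand bounded by `1` on a set of finite measure because `t - s ≥ 1`. Having
-- the time integral inside exposes the oscillation in `s` separately for each `y`.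
open Complex in
theorem schrodingerSol_testForcing_eq (n : ℕ) {R η t : ℝ} (hR : 0 < R) (hη : 0 < η) (ht : 2 ≤ t)
    (x : EuclideanSpace ℝ (Fin n)) :
    schrodingerSol (testForcing n R η) t x = (((4 * Real.pi) ^ (-(n : ℝ) / 2) : ℝ) : ℂ) *
      ∫ y in Metric.ball (0 : EuclideanSpace ℝ (Fin n)) (η / R),
        ∫ s in (0 : ℝ)..1, cexp (I * chirpPhase R ‖x - y‖ t s) * kernelAmp n t s := by
  unfold schrodingerSol
  congr 1
  have e : ∀ s : ℝ, ∫ y : EuclideanSpace ℝ (Fin n),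
      Complex.exp (-(Complex.I * ((‖x - y‖ ^ 2 / (4 * (t - s)) : ℝ) : ℂ))) /
        (((t - s) ^ ((n : ℝ) / 2) : ℝ) : ℂ) * testForcing n R η s y =
      ∫ y in Metric.ball (0 : EuclideanSpace ℝ (Fin n)) (η / R),
        cexp (I * chirpPhase R ‖x - y‖ t s) * kernelAmp n t s := by
    intro s
    rw [← integral_indicator Metric.isOpen_ball.measurableSet]
    refine integral_congr_ae (Filter.Eventually.of_forall fun y => ?_)
    simp only [testForcing_eq n hR hη]
    by_cases h : y ∈ Metric.ball (0 : EuclideanSpace ℝ (Fin n)) (η / R)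
    · simp only [Set.indicator_of_mem h]
      rw [div_mul_eq_mul_div, ← Complex.exp_add, kernelAmp, ofReal_inv, div_eq_mul_inv]
      congr 2
      simp only [chirpPhase]
      push_cast
      ring
    · simp only [Set.indicator_of_notMem h, mul_zero]
  simp only [e, intervalIntegral.integral_of_le zero_le_one]
  have hfin : IsFiniteMeasure (volume.restrict
      (Metric.ball (0 : EuclideanSpace ℝ (Fin n)) (η / R))) := ⟨by
    rw [Measure.restrict_apply_univ]; exact measure_ball_lt_top⟩
  refine integral_integral_swap ?_
  refine Integrable.of_bound (C := 1) ?_ ?_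
  · refine Measurable.aestronglyMeasurable ?_
    simp only [Function.uncurry_def, chirpPhase, kernelAmp]
    fun_prop
  · rw [Measure.prod_restrict]
    refine ae_restrict_of_forall_mem (measurableSet_Ioc.prod Metric.isOpen_ball.measurableSet) ?_
    rintro ⟨s, y⟩ ⟨hs, -⟩
    have h0 : 1 ≤ t - s := by linarith [hs.2]
    simp only [Function.uncurry]
    rw [norm_mul, norm_exp_I_mul_ofReal', one_mul, norm_real,
      Real.norm_of_nonneg (kernelAmp_pos (by linarith)).le]
    exact kernelAmp_le_one h0

/-- The pointwise lower bound for the solution on the annulus. -/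
theorem le_norm_schrodingerSol_testForcing {n : ℕ} (hn : 1 ≤ n) {R η t : ℝ}
    (hη : 0 < η) (hη1 : η ≤ 1) (hη0 : η * (358400 * n * (3 : ℝ) ^ ((n : ℝ) / 2)) ≤ 1)
    (hR : 25600 * (n : ℝ) ^ 2 * (3 : ℝ) ^ ((n : ℝ) / 2) ≤ R) (hR4 : 4 ≤ R)
    (ht : 2 ≤ t) (ht3 : t ≤ 3)
    {x : EuclideanSpace ℝ (Fin n)} (hx0 : 0 < ‖x‖) (hx : ‖x‖ ≤ 2 * R) :
    (4 * Real.pi) ^ (-(n : ℝ) / 2) * (volume.real (Metric.ball (0 : EuclideanSpace ℝ (Fin n)) 1) *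
      (((3 : ℝ) ^ ((n : ℝ) / 2))⁻¹ / 10240)) * (η ^ n / R ^ (n + 1)) ≤
      ‖schrodingerSol (testForcing n R η) t x‖ := by
  have hR0 : 0 < R := by linarith
  set B : ℝ := (3 : ℝ) ^ ((n : ℝ) / 2) with hB
  have hB0 : 0 < B := by positivity
  set ω := volume.real (Metric.ball (0 : EuclideanSpace ℝ (Fin n)) 1) with hω
  set Q : EuclideanSpace ℝ (Fin n) → ℂ := fun y =>
    ∫ s in (0 : ℝ)..1, Complex.exp (Complex.I * chirpPhase R ‖x - y‖ t s) * kernelAmp n t s with hQ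
  have hP : 0 < (4 * Real.pi) ^ (-(n : ℝ) / 2) := by positivity
  rw [schrodingerSol_testForcing_eq n hR0 hη ht, norm_mul, Complex.norm_real,
    Real.norm_of_nonneg hP.le, mul_assoc]
  refine mul_le_mul_of_nonneg_left ?_ hP.le
  set P : ℂ := ∫ s in (0 : ℝ)..1, Complex.exp (Complex.I * chirpPhase R ‖x‖ t s) * kernelAmp n t s
    with hPd
  have hP1 : B⁻¹ / 5120 / R ≤ ‖P‖ := le_norm_integral_exp_chirpPhase hn hR hx0 hx ht ht3
  -- The variation `35nη/R` must be at most half of the lower bound for `‖P‖`, which gives the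
  -- smallness constant `358400 = 35 · 10240`.
  have hdiff : ∀ y ∈ Metric.ball (0 : EuclideanSpace ℝ (Fin n)) (η / R),
      ‖Q y - P‖ ≤ B⁻¹ / 10240 / R := by
    intro y hy
    rw [mem_ball_zero_iff] at hy
    have hyR : ‖y‖ * R ≤ η := by rw [lt_div_iff₀ hR0] at hy; exact hy.le
    have hy1 : ‖y‖ ≤ R := by nlinarith [norm_nonneg y]
    have h1 : |‖x‖ - ‖x - y‖| ≤ ‖y‖ := by
      have := abs_norm_sub_norm_le x (x - y)
      rwa [sub_sub_cancel] at this
    -- The two norms add up to at most `2R + 3R` and differ by at most `‖y‖ ≤ η/R`.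
    have hD : |‖x‖ ^ 2 - ‖x - y‖ ^ 2| ≤ 5 * η := by
      have h2 : ‖x - y‖ ≤ ‖x‖ + ‖y‖ := norm_sub_le _ _
      rw [sq_sub_sq, abs_mul, abs_of_nonneg (by positivity)]
      calc _ ≤ (5 * R) * ‖y‖ := mul_le_mul (by linarith) h1 (abs_nonneg _) (by positivity)
        _ ≤ 5 * η := by linarith
    refine (norm_integral_exp_chirpPhase_sub_le hn hR4 hx0 hx ht hD).trans ?_
    refine div_le_div_of_nonneg_right ?_ hR0.le
    rw [inv_eq_one_div, div_div, le_div_iff₀ (by positivity)]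
    nlinarith
  have hfin : volume (Metric.ball (0 : EuclideanSpace ℝ (Fin n)) (η / R)) < ⊤ := measure_ball_lt_top
  have hvol := volume_real_ball n hn 0 (div_pos hη hR0)
  rw [← hω] at hvol
  have hlow : volume.real (Metric.ball (0 : EuclideanSpace ℝ (Fin n)) (η / R)) *
      (B⁻¹ / 10240 / R) ≤ ‖∫ y in Metric.ball (0 : EuclideanSpace ℝ (Fin n)) (η / R), Q y‖ := by
    set V := volume.real (Metric.ball (0 : EuclideanSpace ℝ (Fin n)) (η / R)) with hV
    have hV0 : 0 ≤ V := measureReal_nonneg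
    have hQm : StronglyMeasurable Q := by
      simp only [hQ, intervalIntegral.integral_of_le zero_le_one]
      refine StronglyMeasurable.integral_prod_right
        (f := fun y s => Complex.exp (Complex.I * chirpPhase R ‖x - y‖ t s) * kernelAmp n t s) ?_
      refine Measurable.stronglyMeasurable ?_
      simp only [Function.uncurry_def, chirpPhase, kernelAmp]
      fun_prop
    have hQi : IntegrableOn Q (Metric.ball (0 : EuclideanSpace ℝ (Fin n)) (η / R)) := by
      refine Measure.integrableOn_of_bounded (M := ‖P‖ + B⁻¹ / 10240 / R) hfin.ne
        hQm.aestronglyMeasurable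
        (ae_restrict_of_forall_mem Metric.isOpen_ball.measurableSet fun y hy => ?_)
      have := norm_add_le P (Q y - P)
      rw [add_sub_cancel] at this
      linarith [hdiff y hy]
    have h1 : ‖(∫ y in Metric.ball (0 : EuclideanSpace ℝ (Fin n)) (η / R), Q y) - V • P‖ ≤
        B⁻¹ / 10240 / R * V := by
      have e : (∫ y in Metric.ball (0 : EuclideanSpace ℝ (Fin n)) (η / R), Q y) - V • P =
          ∫ y in Metric.ball (0 : EuclideanSpace ℝ (Fin n)) (η / R), (Q y - P) := by
        rw [integral_sub hQi (integrableOn_const hfin.ne), setIntegral_const]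
      rw [e]
      exact norm_setIntegral_le_of_norm_le_const hfin hdiff
    have h2 : ‖V • P‖ = V * ‖P‖ := by rw [norm_smul, Real.norm_of_nonneg hV0]
    have h3 := norm_sub_norm_le (V • P)
      (∫ y in Metric.ball (0 : EuclideanSpace ℝ (Fin n)) (η / R), Q y)
    rw [norm_sub_rev] at h3
    have h4 := mul_le_mul_of_nonneg_left hP1 hV0
    have h5 : V * (B⁻¹ / 5120 / R) = V * (B⁻¹ / 10240 / R) + B⁻¹ / 10240 / R * V := by ring
    linarith
  refine le_trans (le_of_eq ?_) hlow
  rw [hvol, div_pow]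
  field_simp
  ring

/-! ### Exponents and mixed norms -/

theorem Real.rpow_le_max_one {x α : ℝ} (hx : 0 < x) (h0 : 0 ≤ α) (h1 : α ≤ 1) :
    x ^ α ≤ max x 1 := by
  rcases le_total x 1 with h | h
  · exact (Real.rpow_le_one hx.le h h0).trans (le_max_right _ _)
  · exact ((Real.rpow_le_rpow_of_exponent_le h h1).trans_eq (Real.rpow_one x)).trans
      (le_max_left _ _)

theorem Real.min_one_le_rpow {x α : ℝ} (hx : 0 < x) (h0 : 0 ≤ α) (h1 : α ≤ 1) :
    min x 1 ≤ x ^ α := by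
  rcases le_total x 1 with h | h
  · exact (min_le_left _ _).trans ((Real.rpow_one x).symm.le.trans
      (Real.rpow_le_rpow_of_exponent_ge hx h h1))
  · exact (min_le_right _ _).trans (Real.one_le_rpow h h0)

theorem ENNReal.toReal_inv_le_one {p : ℝ≥0∞} (hp : 1 ≤ p) : (p⁻¹).toReal ≤ 1 :=
  ENNReal.toReal_le_of_le_ofReal zero_le_one (by simpa using hp)

theorem ENNReal.toReal_inv_conjExponent {p : ℝ≥0∞} (hp : 1 ≤ p) :
    (p.conjExponent⁻¹).toReal = 1 - (p⁻¹).toReal := by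
  have := ENNReal.HolderConjugate.conjExponent hp
  have h := ENNReal.HolderConjugate.inv_add_inv_eq_one p p.conjExponent
  have h2 := congrArg ENNReal.toReal h
  rw [ENNReal.toReal_add (by simpa using (zero_lt_one.trans_le hp).ne')
    (by simp [ENNReal.conjExponent])] at h2
  simp only [ENNReal.toReal_one] at h2
  linarith

theorem ENNReal.one_le_conjExponent {p : ℝ≥0∞} : 1 ≤ p.conjExponent := le_self_add

section MixedNorm

variable {n : ℕ} {r q M : ℝ≥0∞} {J : Set ℝ} {G : ℝ → EuclideanSpace ℝ (Fin n) → ℂ}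
  {S : Set (EuclideanSpace ℝ (Fin n))}

/-- On a time interval of length one the `L^q` norm of a constant does not depend on `q`. The
exponent `(r⁻¹).toReal` is `0` at `r = ∞`, so that endpoint is included. -/
theorem mixedNorm_le_of_enorm_le (hq : q ≠ 0) (hJ : MeasurableSet J) (hJ1 : volume J = 1)
    (hG : ∀ t ∈ J, ∀ x, ‖G t x‖ₑ ≤ S.indicator (fun _ => M) x) :
    mixedNorm r q J G ≤ M * volume S ^ (r⁻¹).toReal := by
  rw [ENNReal.toReal_inv, ← one_div]
  refine le_trans (eLpNorm_mono_enorm fun x => ?_) (eLpNorm_indicator_const_le M r)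
  have hμ : volume.restrict J ≠ 0 := by
    rw [Ne, Measure.restrict_eq_zero, hJ1]; exact one_ne_zero
  calc eLpNorm (fun t => G t x) q (volume.restrict J)
      ≤ eLpNorm (fun _ : ℝ => S.indicator (fun _ => M) x) q (volume.restrict J) :=
        eLpNorm_mono_enorm_ae (ae_restrict_of_forall_mem hJ fun t ht => hG t ht x)
    _ = _ := by rw [eLpNorm_const _ hq hμ]; simp [hJ1]

/-- The hypothesis `volume S ≠ 0` matters at `r = ∞`, where the left side is `M` although a null set
contributes nothing to the norm. -/
theorem le_mixedNorm_of_le_enorm (hr : r ≠ 0) (hq : q ≠ 0) (hJ : MeasurableSet J)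
    (hJ1 : volume J = 1) (hS : MeasurableSet S) (hS0 : volume S ≠ 0)
    (hG : ∀ t ∈ J, ∀ x ∈ S, M ≤ ‖G t x‖ₑ) :
    M * volume S ^ (r⁻¹).toReal ≤ mixedNorm r q J G := by
  rw [ENNReal.toReal_inv, ← one_div]
  have hμ : volume.restrict J ≠ 0 := by
    rw [Ne, Measure.restrict_eq_zero, hJ1]; exact one_ne_zero
  refine le_trans (eLpNorm_indicator_const' (c := M) hS hS0 hr).symm.le
    (eLpNorm_mono_enorm fun x => ?_)
  by_cases hx : x ∈ S
  · rw [Set.indicator_of_mem hx]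
    calc ‖M‖ₑ = eLpNorm (fun _ : ℝ => M) q (volume.restrict J) := by
          rw [eLpNorm_const _ hq hμ]; simp [hJ1]
      _ ≤ eLpNorm (fun t => G t x) q (volume.restrict J) :=
        eLpNorm_mono_enorm_ae (ae_restrict_of_forall_mem hJ fun t ht => hG t ht x hx)
  · rw [Set.indicator_of_notMem hx]; simp

end MixedNorm

/-- The volume of the unit ball of `ℝⁿ`. -/
def unitBallVolume (n : ℕ) : ℝ := volume.real (Metric.ball (0 : EuclideanSpace ℝ (Fin n)) 1)

theorem unitBallVolume_pos (n : ℕ) : 0 < unitBallVolume n :=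
  ENNReal.toReal_pos (Metric.measure_ball_pos _ _ one_pos).ne' measure_ball_lt_top.ne

theorem volume_ball_rpow {n : ℕ} (hn : 1 ≤ n) (x : EuclideanSpace ℝ (Fin n)) {ρ : ℝ} (hρ : 0 < ρ)
    (α : ℝ) : volume (Metric.ball x ρ) ^ α =
      ENNReal.ofReal (ρ ^ ((n : ℝ) * α) * unitBallVolume n ^ α) := by
  have h := volume_real_ball n hn x hρ
  have hω := unitBallVolume_pos n
  rw [← unitBallVolume] at h
  have h2 : volume (Metric.ball x ρ) = ENNReal.ofReal (ρ ^ n * unitBallVolume n) := by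
    rw [← h, measureReal_def, ENNReal.ofReal_toReal measure_ball_lt_top.ne]
  rw [h2, ENNReal.ofReal_rpow_of_pos (by positivity), Real.mul_rpow (by positivity) hω.le,
    ← Real.rpow_natCast, ← Real.rpow_mul hρ.le]

theorem enorm_testForcing {n : ℕ} {R η : ℝ} (hR : 0 < R) (hη : 0 < η) (s : ℝ)
    (y : EuclideanSpace ℝ (Fin n)) : ‖testForcing n R η s y‖ₑ =
      (Metric.ball (0 : EuclideanSpace ℝ (Fin n)) (η / R)).indicator (fun _ => (1 : ℝ≥0∞)) y := by
  rw [testForcing_eq n hR hη]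
  by_cases h : y ∈ Metric.ball (0 : EuclideanSpace ℝ (Fin n)) (η / R)
  · simp only [Set.indicator_of_mem h]
    rw [← ofReal_norm, norm_exp_I_mul_ofReal', ENNReal.ofReal_one]
  · simp only [Set.indicator_of_notMem h, enorm_zero]

theorem mixedNorm_testForcing {n : ℕ} (hn : 1 ≤ n) {R η : ℝ} (hR : 0 < R) (hη : 0 < η)
    {r q : ℝ≥0∞} (hr : r ≠ 0) (hq : q ≠ 0) :
    mixedNorm r q (Set.Icc 0 1) (testForcing n R η) =
      ENNReal.ofReal ((η / R) ^ ((n : ℝ) * (r⁻¹).toReal) * unitBallVolume n ^ (r⁻¹).toReal) := by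
  have hJ1 : volume (Set.Icc (0 : ℝ) 1) = 1 := by simp
  rw [← volume_ball_rpow hn 0 (div_pos hη hR)]
  refine le_antisymm ?_ ?_
  · refine (mixedNorm_le_of_enorm_le (M := 1) hq measurableSet_Icc hJ1
      fun t _ x => (enorm_testForcing hR hη t x).le).trans_eq (one_mul _)
  · refine (one_mul _).symm.trans_le (le_mixedNorm_of_le_enorm (M := 1) hr hq measurableSet_Icc hJ1
      Metric.isOpen_ball.measurableSet (Metric.measure_ball_pos _ _ (div_pos hη hR)).ne'
      fun t _ x hx => ?_)
    rw [enorm_testForcing hR hη, Set.indicator_of_mem hx]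

/-! ### Lower bound for the ratio of norms -/

theorem exists_ball_subset_annulus {n : ℕ} (hn : 1 ≤ n) {R η : ℝ} (hR : 4 ≤ R)
    (hη1 : η < 1) : ∃ z : EuclideanSpace ℝ (Fin n), ∀ x ∈ Metric.ball z (R / 4),
      R + η / R < ‖x‖ ∧ ‖x‖ < 2 * R - η / R := by
  have hR0 : 0 < R := by linarith
  -- A ball of radius `R/4` about a point of norm `3R/2` has norms strictly between `5R/4` and
  -- `7R/4`, and the collar `η/R` is below `1/4`.
  refine ⟨EuclideanSpace.single ⟨0, hn⟩ (3 / 2 * R), fun x hx => ?_⟩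
  have hz : ‖(EuclideanSpace.single ⟨0, hn⟩ (3 / 2 * R) : EuclideanSpace ℝ (Fin n))‖ =
      3 / 2 * R := by
    rw [PiLp.norm_single, Real.norm_of_nonneg (by positivity)]
  rw [mem_ball_iff_norm] at hx
  have h1 := abs_le.1 (abs_norm_sub_norm_le x (EuclideanSpace.single ⟨0, hn⟩ (3 / 2 * R)))
  rw [hz] at h1
  have h2 : η / R < 1 / 4 := by
    rw [div_lt_iff₀ hR0]; linarith
  constructor <;> linarith [h1.1, h1.2]

/-- The constants are uniform in the Lebesgue exponents because `1/r` and `1/r̃` range over `[0,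
1]`: powers of fixed volumes then lie between their minimum and their maximum with `1`. -/
theorem testForcing_analysis (n : ℕ) (hn : 1 ≤ n) :
    ∃ c C η₀ R₀ : ℝ, 0 < c ∧ 0 < C ∧ 0 < η₀ ∧ η₀ < 1 ∧ 4 ≤ R₀ ∧
      ∀ η R : ℝ, 0 < η → η ≤ η₀ → R₀ ≤ R →
        (∀ t ∈ Set.Icc (2 : ℝ) 3, ∀ x : EuclideanSpace ℝ (Fin n),
          R + η / R < ‖x‖ → ‖x‖ < 2 * R - η / R →
            c * (η ^ n / R ^ (n + 1)) ≤ ‖schrodingerSol (testForcing n R η) t x‖) ∧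
        ∀ q r qt rt : ℝ≥0∞, 1 ≤ q → 1 ≤ r → 1 ≤ qt → 1 ≤ rt →
          ENNReal.ofReal (c * (η / R) ^ ((n : ℝ) * (rt.conjExponent⁻¹).toReal)) ≤
            mixedNorm rt.conjExponent qt.conjExponent (Set.Icc 0 1) (testForcing n R η) ∧
          mixedNorm rt.conjExponent qt.conjExponent (Set.Icc 0 1) (testForcing n R η) ≤
            ENNReal.ofReal (C * (η / R) ^ ((n : ℝ) * (rt.conjExponent⁻¹).toReal)) ∧
          ENNReal.ofReal (c * η ^ ((n : ℝ) * (rt⁻¹).toReal) *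
              R ^ ((n : ℝ) * ((r⁻¹).toReal - (rt⁻¹).toReal) - 1)) *
            mixedNorm rt.conjExponent qt.conjExponent (Set.Icc 0 1) (testForcing n R η) ≤
              mixedNorm r q (Set.Icc 2 3) (schrodingerSol (testForcing n R η)) := by
  have hn' : (1 : ℝ) ≤ n := by exact_mod_cast hn
  set B : ℝ := (3 : ℝ) ^ ((n : ℝ) / 2) with hB
  have hB1 : 1 ≤ B := Real.one_le_rpow (by norm_num) (by positivity)
  set ω := unitBallVolume n with hω
  have hω0 : 0 < ω := unitBallVolume_pos n
  set c₀ : ℝ := (4 * Real.pi) ^ (-(n : ℝ) / 2) * (ω * (B⁻¹ / 10240)) with hc₀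
  have hc₀0 : 0 < c₀ := by positivity
  set M := max ω 1 with hM
  have hM1 : 1 ≤ M := le_max_right _ _
  set m := min (ω * (4 ^ n)⁻¹) 1 with hm
  have hm0 : 0 < m := lt_min (by positivity) one_pos
  -- One constant serves all three bounds: `c ≤ c₀` for the pointwise one, `c ≤ min ω 1` for the
  -- size of the forcing, `c * M ≤ c₀ * m` for the ratio.
  set c := min (c₀ * m / M) (min c₀ (min ω 1)) with hc
  have hc0 : 0 < c := by
    refine lt_min (by positivity) (lt_min hc₀0 (lt_min hω0 one_pos))
  have hcc₀ : c ≤ c₀ := (min_le_right _ _).trans (min_le_left _ _)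
  have hcω : c ≤ min ω 1 := (min_le_right _ _).trans (min_le_right _ _)
  have hcM : c * M ≤ c₀ * m := by
    rw [← le_div_iff₀ (by positivity)]; exact min_le_left _ _
  have hnB : 1 ≤ n * B := one_le_mul_of_one_le_of_one_le hn' hB1
  have hnB2 : 1 ≤ (n : ℝ) ^ 2 * B := one_le_mul_of_one_le_of_one_le (one_le_pow₀ hn') hB1
  refine ⟨c, M, 1 / (358400 * n * B), 25600 * (n : ℝ) ^ 2 * B, hc0, by positivity, by positivity,
    ?_, by linarith, ?_⟩
  · rw [div_lt_one (by positivity)]; linarith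
  intro η R hη hη0 hR
  have hη2 : η * (358400 * n * B) ≤ 1 := by rwa [le_div_iff₀ (by positivity)] at hη0
  have hη1 : η < 1 := by
    by_contra! h
    nlinarith
  have hR4 : 4 ≤ R := by linarith
  have hR0 : 0 < R := by linarith
  have hηR : 0 < η / R := div_pos hη hR0
  have hpt : ∀ t ∈ Set.Icc (2 : ℝ) 3, ∀ x : EuclideanSpace ℝ (Fin n),
      R + η / R < ‖x‖ → ‖x‖ < 2 * R - η / R →
        c₀ * (η ^ n / R ^ (n + 1)) ≤ ‖schrodingerSol (testForcing n R η) t x‖ :=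
    fun t ht x h1 h2 => le_norm_schrodingerSol_testForcing hn hη hη1.le hη2 hR hR4 ht.1 ht.2
      (by linarith) (by linarith)
  refine ⟨fun t ht x h1 h2 => le_trans ?_ (hpt t ht x h1 h2), ?_⟩
  · gcongr
  intro q r qt rt hq hr hqt hrt
  have hcr : rt.conjExponent ≠ 0 := (zero_lt_one.trans_le ENNReal.one_le_conjExponent).ne'
  have hcq : qt.conjExponent ≠ 0 := (zero_lt_one.trans_le ENNReal.one_le_conjExponent).ne'
  rw [mixedNorm_testForcing hn hR0 hη hcr hcq, ENNReal.toReal_inv_conjExponent hrt]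
  have hβ0 : 0 ≤ (rt⁻¹).toReal := ENNReal.toReal_nonneg
  have hβ1 : (rt⁻¹).toReal ≤ 1 := ENNReal.toReal_inv_le_one hrt
  have hα0 : 0 ≤ (r⁻¹).toReal := ENNReal.toReal_nonneg
  have hα1 : (r⁻¹).toReal ≤ 1 := ENNReal.toReal_inv_le_one hr
  set α := (r⁻¹).toReal
  set β := (rt⁻¹).toReal
  have hw1 : min ω 1 ≤ ω ^ (1 - β) := Real.min_one_le_rpow hω0 (by linarith) (by linarith)
  have hw2 : ω ^ (1 - β) ≤ M := Real.rpow_le_max_one hω0 (by linarith) (by linarith)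
  refine ⟨?_, ?_, ?_⟩
  · apply ENNReal.ofReal_le_ofReal
    rw [mul_comm]
    gcongr
    exact hcω.trans hw1
  · apply ENNReal.ofReal_le_ofReal
    rw [mul_comm M]
    gcongr
  · obtain ⟨z, hz⟩ := exists_ball_subset_annulus hn hR4 hη1
    have hlow := le_mixedNorm_of_le_enorm (r := r) (q := q) (J := Set.Icc 2 3)
      (M := ENNReal.ofReal (c₀ * (η ^ n / R ^ (n + 1)))) (S := Metric.ball z (R / 4))
      (G := schrodingerSol (testForcing n R η)) (zero_lt_one.trans_le hr).ne'
      (zero_lt_one.trans_le hq).ne' measurableSet_Icc (by norm_num [Real.volume_Icc])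
      Metric.isOpen_ball.measurableSet (Metric.measure_ball_pos _ _ (by positivity)).ne' ?_
    swap
    · intro t ht x hx
      rw [← ofReal_norm]
      exact ENNReal.ofReal_le_ofReal (hpt t ht x (hz x hx).1 (hz x hx).2)
    refine le_trans ?_ hlow
    rw [volume_ball_rpow hn z (by positivity), ← ENNReal.ofReal_mul (by positivity),
      ← ENNReal.ofReal_mul (by positivity)]
    apply ENNReal.ofReal_le_ofReal
    have e1 : c * η ^ ((n : ℝ) * β) * R ^ ((n : ℝ) * (α - β) - 1) *
        ((η / R) ^ ((n : ℝ) * (1 - β)) * ω ^ (1 - β)) =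
        (c * ω ^ (1 - β)) * (η ^ n * R ^ ((n : ℝ) * α - n - 1)) := by
      have a1 : η ^ n = η ^ ((n : ℝ) * β) * η ^ ((n : ℝ) * (1 - β)) := by
        rw [← Real.rpow_add hη, ← Real.rpow_natCast]; congr 1; ring
      have a2 : R ^ ((n : ℝ) * (α - β) - 1) =
          R ^ ((n : ℝ) * α - n - 1) * R ^ ((n : ℝ) * (1 - β)) := by
        rw [← Real.rpow_add hR0]; congr 1; ring
      have a3 : 0 < R ^ ((n : ℝ) * (1 - β)) := by positivity
      rw [Real.div_rpow hη.le hR0.le, a1, a2]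
      field_simp
    have e2 : c₀ * (η ^ n / R ^ (n + 1)) * ((R / 4) ^ ((n : ℝ) * α) * unitBallVolume n ^ α) =
        (c₀ * (ω * (4 ^ n)⁻¹) ^ α) * (η ^ n * R ^ ((n : ℝ) * α - n - 1)) := by
      have a1 : R ^ ((n : ℝ) * α - n - 1) = R ^ ((n : ℝ) * α) / R ^ (n + 1) := by
        rw [sub_sub, Real.rpow_sub hR0]
        congr 1
        exact_mod_cast Real.rpow_natCast R (n + 1)
      have a2 : (ω * ((4 : ℝ) ^ n)⁻¹) ^ α = ω ^ α / 4 ^ ((n : ℝ) * α) := by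
        rw [← div_eq_mul_inv, Real.div_rpow hω0.le (by positivity), ← Real.rpow_natCast,
          ← Real.rpow_mul (by norm_num)]
      rw [a1, a2, Real.div_rpow hR0.le (by norm_num)]
      ring
    rw [e1, e2]
    refine mul_le_mul_of_nonneg_right ?_ (by positivity)
    calc c * ω ^ (1 - β) ≤ c * M := by gcongr
      _ ≤ c₀ * m := hcM
      _ ≤ c₀ * (ω * (4 ^ n)⁻¹) ^ α := by
        gcongr
        exact Real.min_one_le_rpow (by positivity) hα0 hα1

/-! ### Time reflection and duality -/

/-- The Schrödinger kernel at time `τ` and distance `ρ`. -/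
def schrodingerKernel (n : ℕ) (τ ρ : ℝ) : ℂ :=
  (((4 * Real.pi) ^ (-(n : ℝ) / 2) : ℝ) : ℂ) *
    (Complex.exp (-(Complex.I * ((ρ ^ 2 / (4 * τ) : ℝ) : ℂ))) / ((τ ^ ((n : ℝ) / 2) : ℝ) : ℂ))

theorem norm_schrodingerKernel_le {n : ℕ} {τ : ℝ} (hτ : 1 ≤ τ) (ρ : ℝ) :
    ‖schrodingerKernel n τ ρ‖ ≤ (4 * Real.pi) ^ (-(n : ℝ) / 2) := by
  have h0 : 0 ≤ (4 * Real.pi) ^ (-(n : ℝ) / 2) := by positivity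
  have h1 : 1 ≤ τ ^ ((n : ℝ) / 2) := Real.one_le_rpow hτ (by positivity)
  have h2 := norm_exp_I_mul_ofReal' (-(ρ ^ 2 / (4 * τ)))
  rw [Complex.ofReal_neg, mul_neg] at h2
  rw [schrodingerKernel, norm_mul, norm_div, h2, Complex.norm_real, Complex.norm_real,
    Real.norm_of_nonneg h0, Real.norm_of_nonneg (by linarith)]
  exact mul_le_of_le_one_right h0 ((div_le_one (by linarith)).2 h1)

/-- The measure `ds dy` on `(0, 1] × B(0, ρ)`. -/
def slabMeasure (n : ℕ) (ρ : ℝ) : Measure (ℝ × EuclideanSpace ℝ (Fin n)) :=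
  (volume.restrict (Set.Ioc 0 1)).prod (volume.restrict (Metric.closedBall 0 ρ))

instance (n : ℕ) (ρ : ℝ) : IsFiniteMeasure
    (volume.restrict (Metric.closedBall (0 : EuclideanSpace ℝ (Fin n)) ρ)) := ⟨by
  rw [Measure.restrict_apply_univ]; exact measure_closedBall_lt_top⟩

instance (n : ℕ) (ρ : ℝ) : IsFiniteMeasure (slabMeasure n ρ) := by
  unfold slabMeasure; infer_instance

section Duality

variable {n : ℕ} {ρ : ℝ} {F g : ℝ → EuclideanSpace ℝ (Fin n) → ℂ}

theorem ae_slabMeasure {p : ℝ × EuclideanSpace ℝ (Fin n) → Prop}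
    (h : ∀ s ∈ Set.Ioc (0 : ℝ) 1, ∀ y, p (s, y)) : ∀ᵐ z ∂slabMeasure n ρ, p z := by
  rw [slabMeasure, Measure.prod_restrict]
  exact ae_restrict_of_forall_mem (measurableSet_Ioc.prod measurableSet_closedBall)
    fun z hz => h z.1 hz.1 z.2

/-- A single integral against a finite measure, with a bounded integrand, reduces the symmetry of
the pairing to one application of Fubini. -/
theorem schrodingerSol_eq_integral_slabMeasure (hF : Measurable (Function.uncurry F))
    {M : ℝ} (hM : ∀ s y, ‖F s y‖ ≤ M) (hρ : ∀ s y, ρ < ‖y‖ → F s y = 0) {t : ℝ} (ht : 2 ≤ t)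
    (x : EuclideanSpace ℝ (Fin n)) :
    schrodingerSol F t x =
      ∫ p, schrodingerKernel n (t - p.1) ‖x - p.2‖ * F p.1 p.2 ∂slabMeasure n ρ := by
  rw [slabMeasure, integral_prod]
  · rw [schrodingerSol, intervalIntegral.integral_of_le zero_le_one, ← integral_const_mul]
    refine integral_congr_ae (Filter.Eventually.of_forall fun s => ?_)
    simp only
    rw [← integral_const_mul, setIntegral_eq_integral_of_forall_compl_eq_zero]
    · refine integral_congr_ae (Filter.Eventually.of_forall fun y => ?_)
      simp only [schrodingerKernel]
      ring
    · intro y hy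
      rw [Metric.mem_closedBall, dist_zero_right, not_le] at hy
      rw [hρ s y hy, mul_zero]
  · have hM0 : 0 ≤ M := (norm_nonneg _).trans (hM 0 0)
    refine Integrable.of_bound (C := (4 * Real.pi) ^ (-(n : ℝ) / 2) * M) ?_
      (ae_slabMeasure fun s hs y => ?_)
    · refine Measurable.aestronglyMeasurable ?_
      have : Measurable fun p : ℝ × EuclideanSpace ℝ (Fin n) => F p.1 p.2 := hF
      unfold schrodingerKernel
      fun_prop
    · rw [norm_mul]
      exact mul_le_mul (norm_schrodingerKernel_le (by linarith [hs.2]) _) (hM s y)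
        (norm_nonneg _) (by positivity)

/-- The solution operator composed with the time reflection `t ↦ 3 - t` is symmetric. -/
theorem integral_schrodingerSol_mul_comm (hF : Measurable (Function.uncurry F))
    (hg : Measurable (Function.uncurry g)) {M : ℝ} (hFM : ∀ s y, ‖F s y‖ ≤ M)
    (hgM : ∀ s y, ‖g s y‖ ≤ M) (hFρ : ∀ s y, ρ < ‖y‖ → F s y = 0)
    (hgρ : ∀ s y, ρ < ‖y‖ → g s y = 0) :
    ∫ s in (0 : ℝ)..1, ∫ x, schrodingerSol F (3 - s) x * g s x =
      ∫ s in (0 : ℝ)..1, ∫ y, F s y * schrodingerSol g (3 - s) y := by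
  have hM0 : 0 ≤ M := (norm_nonneg _).trans (hFM 0 0)
  have mF : Measurable fun p : ℝ × EuclideanSpace ℝ (Fin n) => F p.1 p.2 := hF
  have mg : Measurable fun p : ℝ × EuclideanSpace ℝ (Fin n) => g p.1 p.2 := hg
  -- After reflection the elapsed time is `3 - s' - s`, symmetric in the two times and at least `1`
  -- on the slab, where the kernel is bounded.
  set Φ : ℝ × EuclideanSpace ℝ (Fin n) → ℝ × EuclideanSpace ℝ (Fin n) → ℂ := fun p' p =>
    schrodingerKernel n (3 - p'.1 - p.1) ‖p'.2 - p.2‖ * F p.1 p.2 * g p'.1 p'.2 with hΦ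
  have hint : Integrable (Function.uncurry Φ) ((slabMeasure n ρ).prod (slabMeasure n ρ)) := by
    refine Integrable.of_bound (C := (4 * Real.pi) ^ (-(n : ℝ) / 2) * M * M) ?_ ?_
    · refine Measurable.aestronglyMeasurable ?_
      have m1 : Measurable fun p : (ℝ × EuclideanSpace ℝ (Fin n)) × (ℝ × EuclideanSpace ℝ (Fin n)) =>
        F p.2.1 p.2.2 := mF.comp measurable_snd
      have m2 : Measurable fun p : (ℝ × EuclideanSpace ℝ (Fin n)) × (ℝ × EuclideanSpace ℝ (Fin n)) =>
        g p.1.1 p.1.2 := mg.comp measurable_fst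
      simp only [hΦ, Function.uncurry_def, schrodingerKernel]
      fun_prop
    · have h1 : ∀ᵐ p ∂slabMeasure n ρ, p.1 ∈ Set.Ioc (0 : ℝ) 1 := ae_slabMeasure fun s hs _ => hs
      have h2 := (Measure.quasiMeasurePreserving_fst (μ := slabMeasure n ρ)
        (ν := slabMeasure n ρ)).ae h1
      have h3 := (Measure.quasiMeasurePreserving_snd (μ := slabMeasure n ρ)
        (ν := slabMeasure n ρ)).ae h1
      filter_upwards [h2, h3] with p hp1 hp2
      simp only [Function.uncurry, hΦ, norm_mul]
      have := norm_schrodingerKernel_le (n := n) (τ := 3 - p.1.1 - p.2.1)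
        (by linarith [hp1.2, hp2.2]) ‖p.1.2 - p.2.2‖
      gcongr
      · exact hFM _ _
      · exact hgM _ _
  have restrict : ∀ H : ℝ → EuclideanSpace ℝ (Fin n) → ℂ,
      (∀ s y, ρ < ‖y‖ → H s y = 0) → Integrable (fun p => H p.1 p.2) (slabMeasure n ρ) →
      ∫ s in (0 : ℝ)..1, ∫ x, H s x = ∫ p, H p.1 p.2 ∂slabMeasure n ρ := by
    intro H h0 hi
    rw [slabMeasure] at hi ⊢
    rw [integral_prod _ hi, intervalIntegral.integral_of_le zero_le_one]
    refine integral_congr_ae (Filter.Eventually.of_forall fun s => ?_)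
    simp only
    rw [setIntegral_eq_integral_of_forall_compl_eq_zero]
    intro y hy
    rw [Metric.mem_closedBall, dist_zero_right, not_le] at hy
    exact h0 s y hy
  have eF : (fun p : ℝ × EuclideanSpace ℝ (Fin n) => schrodingerSol F (3 - p.1) p.2 * g p.1 p.2)
      =ᵐ[slabMeasure n ρ] fun p' => ∫ p, Φ p' p ∂slabMeasure n ρ := by
    refine ae_slabMeasure fun s hs x => ?_
    simp only [hΦ]
    rw [integral_mul_const, schrodingerSol_eq_integral_slabMeasure hF hFM hFρ
      (by linarith [hs.2])]
  have eg : (fun p : ℝ × EuclideanSpace ℝ (Fin n) => F p.1 p.2 * schrodingerSol g (3 - p.1) p.2)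
      =ᵐ[slabMeasure n ρ] fun p => ∫ p', Φ p' p ∂slabMeasure n ρ := by
    refine ae_slabMeasure fun s hs y => ?_
    simp only [hΦ]
    rw [schrodingerSol_eq_integral_slabMeasure hg hgM hgρ (by linarith [hs.2]),
      ← integral_const_mul]
    refine integral_congr_ae (Filter.Eventually.of_forall fun p' => ?_)
    simp only
    rw [norm_sub_rev y p'.2, sub_right_comm]
    ring
  rw [restrict (fun s x => schrodingerSol F (3 - s) x * g s x) (fun s y hy => by rw [hgρ s y hy, mul_zero])
      (hint.integral_prod_left.congr eF.symm),
    restrict (fun s y => F s y * schrodingerSol g (3 - s) y) (fun s y hy => by rw [hFρ s y hy, zero_mul])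
      (hint.integral_prod_right.congr eg.symm),
    integral_congr_ae eF, integral_congr_ae eg]
  exact integral_integral_swap hint

theorem measurable_schrodingerSol (hF : Measurable (Function.uncurry F)) :
    Measurable (Function.uncurry (schrodingerSol F)) := by
  have mF : Measurable fun p : ℝ × EuclideanSpace ℝ (Fin n) => F p.1 p.2 := hF
  simp only [Function.uncurry_def, schrodingerSol, intervalIntegral.integral_of_le zero_le_one]
  refine measurable_const.mul (StronglyMeasurable.measurable ?_)
  refine StronglyMeasurable.integral_prod_right (f := fun (p : ℝ × EuclideanSpace ℝ (Fin n))
    (s : ℝ) => ∫ y, Complex.exp (-(Complex.I * ((‖p.2 - y‖ ^ 2 / (4 * (p.1 - s)) : ℝ) : ℂ))) /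
        (((p.1 - s) ^ ((n : ℝ) / 2) : ℝ) : ℂ) * F s y) ?_
  refine StronglyMeasurable.integral_prod_right (f := fun
    (w : (ℝ × EuclideanSpace ℝ (Fin n)) × ℝ) (y : EuclideanSpace ℝ (Fin n)) =>
      Complex.exp (-(Complex.I * ((‖w.1.2 - y‖ ^ 2 / (4 * (w.1.1 - w.2)) : ℝ) : ℂ))) /
        (((w.1.1 - w.2) ^ ((n : ℝ) / 2) : ℝ) : ℂ) * F w.2 y) ?_
  refine Measurable.stronglyMeasurable ?_
  have m1 : Measurable fun z : ((ℝ × EuclideanSpace ℝ (Fin n)) × ℝ) × EuclideanSpace ℝ (Fin n) =>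
    F z.1.2 z.2 := mF.comp (measurable_fst.snd.prodMk measurable_snd)
  simp only [Function.uncurry_def]
  fun_prop

theorem measurable_schrodingerSol_const_sub (hF : Measurable (Function.uncurry F)) (a : ℝ) :
    Measurable fun p : ℝ × EuclideanSpace ℝ (Fin n) => schrodingerSol F (a - p.1) p.2 := by
  have h : Measurable fun p : ℝ × EuclideanSpace ℝ (Fin n) => (a - p.1, p.2) := by fun_prop
  have h2 := (measurable_schrodingerSol hF).comp h
  simp only [Function.comp_def, Function.uncurry_apply_pair] at h2
  exact h2

/-- Hölder's inequality for the pairing with a function bounded by an indicator. -/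
theorem enorm_integral_mul_le_mixedNorm {u : ℝ → EuclideanSpace ℝ (Fin n) → ℂ}
    {S : Set (EuclideanSpace ℝ (Fin n))} {r q : ℝ≥0∞} (hr : 1 ≤ r) (hq : 1 ≤ q)
    (hu : Measurable (Function.uncurry u)) (hS : MeasurableSet S)
    (hg : ∀ s y, ‖g s y‖ₑ ≤ S.indicator (fun _ => (1 : ℝ≥0∞)) y) :
    ‖∫ s in (0 : ℝ)..1, ∫ x, u (3 - s) x * g s x‖ₑ ≤
      mixedNorm r q (Set.Icc 2 3) u * volume S ^ (1 - (r⁻¹).toReal) := by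
  have mu : Measurable fun p : ℝ × EuclideanSpace ℝ (Fin n) => ‖u p.1 p.2‖ₑ := hu.enorm
  set f : EuclideanSpace ℝ (Fin n) → ℝ≥0∞ := fun x => ∫⁻ t in Set.Icc 2 3, ‖u t x‖ₑ with hf
  have mf : Measurable f := Measurable.lintegral_prod_left' mu
  have hprob : IsProbabilityMeasure (volume.restrict (Set.Icc (2 : ℝ) 3)) :=
    ⟨by rw [Measure.restrict_apply_univ, Real.volume_Icc]; norm_num⟩
  have refl : ∀ x, ∫⁻ s in Set.Ioc (0 : ℝ) 1, ‖u (3 - s) x‖ₑ = f x := by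
    intro x
    have mx : Measurable fun t => ‖u t x‖ₑ := mu.comp (measurable_id.prodMk measurable_const)
    have := (Measure.measurePreserving_sub_left volume (3 : ℝ)).setLIntegral_comp_preimage
      (measurableSet_Icc (a := (2 : ℝ)) (b := 3)) mx
    rw [hf]
    simp only
    rw [← this, Set.preimage_const_sub_Icc]
    norm_num only
    exact setLIntegral_congr Ioc_ae_eq_Icc
  calc ‖∫ s in (0 : ℝ)..1, ∫ x, u (3 - s) x * g s x‖ₑ
      ≤ ∫⁻ s in Set.Ioc (0 : ℝ) 1, ∫⁻ x in S, ‖u (3 - s) x‖ₑ := by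
        rw [intervalIntegral.integral_of_le zero_le_one]
        refine (enorm_integral_le_lintegral_enorm _).trans (lintegral_mono fun s => ?_)
        refine (enorm_integral_le_lintegral_enorm _).trans ?_
        rw [← lintegral_indicator hS]
        refine lintegral_mono fun x => ?_
        rw [enorm_mul]
        refine (mul_le_mul_right (hg s x) _).trans ?_
        by_cases hx : x ∈ S <;> simp [hx]
    _ = ∫⁻ x in S, f x := by
        rw [lintegral_lintegral_swap]
        · simp only [refl]
        · exact (mu.comp ((measurable_const.sub measurable_fst).prodMk
            measurable_snd)).aemeasurable
    _ = eLpNorm f 1 (volume.restrict S) := by rw [eLpNorm_one_eq_lintegral_enorm]; rfl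
    -- Hölder in space on the finite-measure set `S` produces the power of its volume; in time, `L¹
    -- ≤ L^q` is free because `[2, 3]` has length one.
    _ ≤ eLpNorm f r (volume.restrict S) * volume S ^ (1 - (r⁻¹).toReal) := by
        have := eLpNorm_le_eLpNorm_mul_rpow_measure_univ (μ := volume.restrict S) hr
          mf.aestronglyMeasurable
        simpa [ENNReal.toReal_inv] using this
    _ ≤ _ := by
        gcongr
        refine (eLpNorm_mono_measure _ Measure.restrict_le_self).trans
          (eLpNorm_mono_enorm fun x => ?_)
        have := eLpNorm_le_eLpNorm_of_exponent_le (μ := volume.restrict (Set.Icc (2 : ℝ) 3)) hq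
          (f := fun t => u t x)
          (hu.comp (measurable_id.prodMk measurable_const)).aestronglyMeasurable
        rwa [eLpNorm_one_eq_lintegral_enorm] at this

end Duality

/-! ### Testing the estimate -/

theorem measurable_testForcing (n : ℕ) (R η : ℝ) :
    Measurable (Function.uncurry (testForcing n R η)) := by
  simp only [Function.uncurry_def, testForcing]
  have : Measurable ((Metric.ball (0 : EuclideanSpace ℝ (Fin n)) 1).indicator
      fun _ => (1 : ℂ)) := measurable_const.indicator Metric.isOpen_ball.measurableSet
  have h2 : Measurable fun p : ℝ × EuclideanSpace ℝ (Fin n) =>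
      (Metric.ball (0 : EuclideanSpace ℝ (Fin n)) 1).indicator (fun _ => (1 : ℂ))
        ((R / η) • p.2) := this.comp (by fun_prop)
  fun_prop

theorem norm_testForcing_le {n : ℕ} {R η : ℝ} (hR : 0 < R) (hη : 0 < η) (s : ℝ)
    (y : EuclideanSpace ℝ (Fin n)) : ‖testForcing n R η s y‖ ≤ 1 := by
  rw [testForcing_eq n hR hη]
  refine (norm_indicator_le_norm_self _ _).trans_eq ?_
  exact norm_exp_I_mul_ofReal' _

theorem testForcing_eq_zero {n : ℕ} {R η : ℝ} (hR : 0 < R) (hη : 0 < η) (s : ℝ)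
    {y : EuclideanSpace ℝ (Fin n)} (hy : η / R < ‖y‖) : testForcing n R η s y = 0 := by
  rw [testForcing_eq n hR hη, Set.indicator_of_notMem]
  rw [mem_ball_zero_iff]
  exact hy.le.not_gt

theorem exponent_nonpos_of_bounded {a e K R₀ : ℝ} (ha : 0 < a)
    (h : ∀ R : ℝ, R₀ ≤ R → a * R ^ e ≤ K) : e ≤ 0 := by
  by_contra! he
  have h1 := (tendsto_rpow_atTop he).const_mul_atTop ha
  obtain ⟨R, hR, hR2⟩ := ((h1.eventually_gt_atTop K).and
    (Filter.eventually_ge_atTop R₀)).exists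
  exact absurd (h R hR2) (not_le.2 hR)

/-- A lower bound for the solution with datum `testForcing` on a ball gives, by duality, a
necessary condition on the constant of the local estimate. -/
theorem le_mul_volume_rpow_of_estimate {n : ℕ} {q r qt rt : ℝ≥0∞} (hq : 1 ≤ q) (hr : 1 ≤ r)
    (hrt : 1 ≤ rt) {K : ℝ≥0}
    (hK : ∀ F : ℝ → EuclideanSpace ℝ (Fin n) → ℂ, Measurable (Function.uncurry F) →
      (∃ M : ℝ, ∀ s y, ‖F s y‖ ≤ M) → (∃ ρ : ℝ, ∀ s y, ρ < ‖y‖ → F s y = 0) →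
      mixedNorm r q (Set.Icc 2 3) (schrodingerSol F) ≤
        K * mixedNorm rt.conjExponent qt.conjExponent (Set.Icc 0 1) F)
    {R η m d : ℝ} (hR : 0 < R) (hη : 0 < η) (hm : 0 < m) {z : EuclideanSpace ℝ (Fin n)}
    (hlow : ∀ t ∈ Set.Icc (2 : ℝ) 3, ∀ x ∈ Metric.ball z d,
      m ≤ ‖schrodingerSol (testForcing n R η) t x‖) :
    ENNReal.ofReal m * volume (Metric.ball z d) ≤
      K * volume (Metric.ball z d) ^ (1 - (rt⁻¹).toReal) *
        volume (Metric.ball (0 : EuclideanSpace ℝ (Fin n)) (η / R)) ^ (1 - (r⁻¹).toReal) := by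
  set g := testForcing n R η with hg
  set A := Metric.ball z d with hA
  have mA : MeasurableSet A := Metric.isOpen_ball.measurableSet
  have mg : Measurable (Function.uncurry g) := measurable_testForcing n R η
  -- Dividing by the solution itself cancels its phase: `F` times the reflected solution is the
  -- constant `m` on `A`, while `|F| ≤ 1` because that solution is at least `m` there.
  set F : ℝ → EuclideanSpace ℝ (Fin n) → ℂ := fun s y =>
    (Set.Icc (0 : ℝ) 1 ×ˢ A).indicator (fun p => (m : ℂ) / schrodingerSol g (3 - p.1) p.2) (s, y)
    with hF
  have mF : Measurable (Function.uncurry F) := by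
    have m1 : Measurable fun p : ℝ × EuclideanSpace ℝ (Fin n) =>
        (m : ℂ) / schrodingerSol g (3 - p.1) p.2 :=
      (measurable_schrodingerSol_const_sub mg 3).const_div (m : ℂ)
    exact m1.indicator (measurableSet_Icc.prod mA)
  have low' : ∀ s ∈ Set.Icc (0 : ℝ) 1, ∀ y ∈ A, m ≤ ‖schrodingerSol g (3 - s) y‖ :=
    fun s hs y hy => hlow _ ⟨by linarith [hs.2], by linarith [hs.1]⟩ y hy
  have hF1 : ∀ s y, ‖F s y‖ ≤ A.indicator (fun _ => (1 : ℝ)) y := by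
    intro s y
    by_cases h : (s, y) ∈ Set.Icc (0 : ℝ) 1 ×ˢ A
    · simp only [hF]
      rw [Set.indicator_of_mem h, Set.indicator_of_mem h.2, norm_div, Complex.norm_real,
        Real.norm_of_nonneg hm.le]
      have := low' s h.1 y h.2
      exact (div_le_one (hm.trans_le this)).2 this
    · simp only [hF]
      rw [Set.indicator_of_notMem h, norm_zero]
      exact Set.indicator_nonneg (fun _ _ => zero_le_one) _
  have hFle : ∀ s y, ‖F s y‖ ≤ 1 := fun s y =>
    (hF1 s y).trans (Set.indicator_le_self' (fun _ _ => zero_le_one) y)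
  have hF0 : ∀ s y, ‖z‖ + d < ‖y‖ → F s y = 0 := by
    intro s y hy
    have : y ∉ A := by
      intro h
      rw [hA, mem_ball_iff_norm] at h
      have := norm_add_le (y - z) z
      rw [sub_add_cancel] at this
      linarith
    have h1 := hF1 s y
    rw [Set.indicator_of_notMem this] at h1
    exact norm_le_zero_iff.1 h1
  have hFe : ∀ s y, ‖F s y‖ₑ ≤ A.indicator (fun _ => (1 : ℝ≥0∞)) y := by
    intro s y
    by_cases hy : y ∈ A
    · rw [Set.indicator_of_mem hy, ← ofReal_norm, ← ENNReal.ofReal_one]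
      exact ENNReal.ofReal_le_ofReal (hFle s y)
    · have h1 := hF1 s y
      rw [Set.indicator_of_notMem hy] at h1
      rw [norm_le_zero_iff.1 h1, enorm_zero]
      exact zero_le
  have hcq : qt.conjExponent ≠ 0 := (zero_lt_one.trans_le ENNReal.one_le_conjExponent).ne'
  have hFn : mixedNorm rt.conjExponent qt.conjExponent (Set.Icc 0 1) F ≤
      volume A ^ (1 - (rt⁻¹).toReal) := by
    have := mixedNorm_le_of_enorm_le (r := rt.conjExponent) (M := 1) hcq
      (measurableSet_Icc (a := (0 : ℝ)) (b := 1)) (by simp) fun t _ x => hFe t x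
    rwa [one_mul, ENNReal.toReal_inv_conjExponent hrt] at this
  have hpair := integral_schrodingerSol_mul_comm (ρ := max (‖z‖ + d) (η / R)) mF mg hFle
    (norm_testForcing_le hR hη)
    (fun s y hy => hF0 s y ((le_max_left _ _).trans_lt hy))
    (fun s y hy => testForcing_eq_zero hR hη s ((le_max_right _ _).trans_lt hy))
  have hright : ∫ s in (0 : ℝ)..1, ∫ y, F s y * schrodingerSol g (3 - s) y =
      ((m * volume.real A : ℝ) : ℂ) := by
    have : ∀ s ∈ Set.uIcc (0 : ℝ) 1, ∫ y, F s y * schrodingerSol g (3 - s) y =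
        ((m * volume.real A : ℝ) : ℂ) := by
      intro s hs
      rw [Set.uIcc_of_le zero_le_one] at hs
      have e : ∀ y, F s y * schrodingerSol g (3 - s) y = A.indicator (fun _ => (m : ℂ)) y := by
        intro y
        simp only [hF]
        by_cases hy : y ∈ A
        · rw [Set.indicator_of_mem (Set.mk_mem_prod hs hy), Set.indicator_of_mem hy]
          exact div_mul_cancel₀ _ (norm_pos_iff.1 (hm.trans_le (low' s hs y hy)))
        · rw [Set.indicator_of_notMem (fun h => hy h.2), Set.indicator_of_notMem hy, zero_mul]
      simp only [e]
      rw [integral_indicator_const _ mA, Complex.real_smul]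
      push_cast; ring
    rw [intervalIntegral.integral_congr this]
    simp
  have hholder := enorm_integral_mul_le_mixedNorm (g := g) hr hq (measurable_schrodingerSol mF)
    Metric.isOpen_ball.measurableSet fun s y => (enorm_testForcing hR hη s y).le
  rw [hpair, hright, ← ofReal_norm, Complex.norm_real,
    Real.norm_of_nonneg (mul_nonneg hm.le measureReal_nonneg), ENNReal.ofReal_mul hm.le,
    ofReal_measureReal measure_ball_lt_top.ne] at hholder
  refine hholder.trans ?_
  gcongr
  refine (hK F mF ⟨1, hFle⟩ ⟨_, hF0⟩).trans ?_
  gcongr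

end

/-! ### The main theorem -/

theorem mainTheorem5 (n : ℕ) (hn : 3 ≤ n) :
    -- analysis of the test forcing term, with constants depending only on `n`
    (∃ c C η₀ R₀ : ℝ, 0 < c ∧ 0 < C ∧ 0 < η₀ ∧ η₀ < 1 ∧ 1 ≤ R₀ ∧
      ∀ η R : ℝ, 0 < η → η ≤ η₀ → R₀ ≤ R →
        -- pointwise lower bound for the solution
        (∀ t ∈ Set.Icc (2 : ℝ) 3, ∀ x : EuclideanSpace ℝ (Fin n),
          R + η / R < ‖x‖ → ‖x‖ < 2 * R - η / R →
            c * (η ^ n / R ^ (n + 1)) ≤ ‖schrodingerSol (testForcing n R η) t x‖) ∧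
        ∀ q r qt rt : ℝ≥0∞, 1 ≤ q → 1 ≤ r → 1 ≤ qt → 1 ≤ rt →
          -- size of the forcing term
          ENNReal.ofReal (c * (η / R) ^ ((n : ℝ) * (rt.conjExponent⁻¹).toReal)) ≤
            mixedNorm rt.conjExponent qt.conjExponent (Set.Icc 0 1) (testForcing n R η) ∧
          mixedNorm rt.conjExponent qt.conjExponent (Set.Icc 0 1) (testForcing n R η) ≤
            ENNReal.ofReal (C * (η / R) ^ ((n : ℝ) * (rt.conjExponent⁻¹).toReal)) ∧
          -- lower bound for the ratio of the two norms
          ENNReal.ofReal (c * η ^ ((n : ℝ) * (rt⁻¹).toReal) *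
              R ^ ((n : ℝ) * ((r⁻¹).toReal - (rt⁻¹).toReal) - 1)) *
            mixedNorm rt.conjExponent qt.conjExponent (Set.Icc 0 1) (testForcing n R η) ≤
              mixedNorm r q (Set.Icc 2 3) (schrodingerSol (testForcing n R η))) ∧
    -- necessary conditions for the estimate
    (∀ q r qt rt : ℝ≥0∞, 1 ≤ q → 1 ≤ r → 1 ≤ qt → 1 ≤ rt →
      LocalMixedEstimate n q r qt rt →
        (r⁻¹).toReal - (rt⁻¹).toReal ≤ 1 / (n : ℝ) ∧
        (rt⁻¹).toReal - (r⁻¹).toReal ≤ 1 / (n : ℝ)) := by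
  have hn1 : 1 ≤ n := by lia
  have hn0 : (0 : ℝ) < n := by exact_mod_cast hn1
  obtain ⟨c, C, η₀, R₀, hc, hC, hη₀, hη₁, hR₀, h⟩ := testForcing_analysis n hn1
  refine ⟨⟨c, C, η₀, R₀, hc, hC, hη₀, hη₁, by linarith, h⟩, ?_⟩
  intro q r qt rt hq hr hqt hrt hest
  obtain ⟨K, hK⟩ := hest
  constructor
  · have key : (n : ℝ) * ((r⁻¹).toReal - (rt⁻¹).toReal) - 1 ≤ 0 := by
      refine exponent_nonpos_of_bounded (a := c * η₀ ^ ((n : ℝ) * (rt⁻¹).toReal)) (K := K)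
        (R₀ := R₀) (by positivity) fun R hR => ?_
      have hR0 : 0 < R := by linarith
      obtain ⟨-, h2⟩ := h η₀ R hη₀ le_rfl hR
      obtain ⟨l1, l2, l3⟩ := h2 q r qt rt hq hr hqt hrt
      have hest := hK (testForcing n R η₀) (measurable_testForcing n R η₀)
        ⟨1, norm_testForcing_le hR0 hη₀⟩ ⟨η₀ / R, fun s y hy => testForcing_eq_zero hR0 hη₀ s hy⟩
      have h3 := l3.trans hest
      -- Cancelling the norm of the forcing requires it to be nonzero and finite, which is what its
      -- two-sided size bound provides.
      rw [ENNReal.mul_le_mul_iff_left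
        ((ENNReal.ofReal_pos.2 (by positivity)).trans_le l1).ne'
        (l2.trans_lt ENNReal.ofReal_lt_top).ne] at h3
      exact (ENNReal.ofReal_le_iff_le_toReal ENNReal.coe_ne_top).1 h3
    rw [le_div_iff₀ hn0]
    linarith
  · set α := (r⁻¹).toReal with hα
    set β := (rt⁻¹).toReal with hβ
    set ω := unitBallVolume n with hω
    have hω0 : 0 < ω := unitBallVolume_pos n
    -- `D` collects the factors free of `R`. With `m ~ R^{-n-1}`, a large ball of volume `~ Rⁿ` and
    -- a small one of volume `~ R^{-n}`, the dual inequality reads `R⁻¹ ≲ R^{n(α-β)}`.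
    set D : ℝ := (4 : ℝ)⁻¹ ^ ((n : ℝ) * (1 - β)) * ω ^ (1 - β) *
      (η₀ ^ ((n : ℝ) * (1 - α)) * ω ^ (1 - α)) with hD
    have hD0 : 0 < D := by positivity
    have key : (n : ℝ) * (β - α) - 1 ≤ 0 := by
      refine exponent_nonpos_of_bounded (a := c * η₀ ^ n * ((4 : ℝ)⁻¹ ^ n * ω) / D) (K := K)
        (R₀ := R₀) (by positivity) fun R hR => ?_
      have hR0 : 0 < R := by linarith
      obtain ⟨h1, -⟩ := h η₀ R hη₀ le_rfl hR
      obtain ⟨z, hz⟩ := exists_ball_subset_annulus hn1 (R := R) (by linarith) hη₁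
      have hmain := le_mul_volume_rpow_of_estimate hq hr hrt hK hR0 hη₀
        (m := c * (η₀ ^ n / R ^ (n + 1))) (by positivity) (z := z) (d := R / 4)
        fun t ht x hx => h1 t ht x (hz x hx).1 (hz x hx).2
      have hv := volume_ball_rpow hn1 z (show 0 < R / 4 by positivity) 1
      rw [ENNReal.rpow_one] at hv
      rw [volume_ball_rpow hn1 z (by positivity), volume_ball_rpow hn1 0 (by positivity), hv,
        ← ENNReal.ofReal_coe_nnreal, ← ENNReal.ofReal_mul (by positivity),
        ← ENNReal.ofReal_mul (by positivity), ← ENNReal.ofReal_mul (by positivity),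
        ENNReal.ofReal_le_ofReal_iff (by positivity), ← hω, ← hα, ← hβ, mul_one, Real.rpow_one,
        Real.rpow_natCast] at hmain
      have e1 : c * (η₀ ^ n / R ^ (n + 1)) * ((R / 4) ^ n * ω) =
          c * η₀ ^ n * ((4 : ℝ)⁻¹ ^ n * ω) * R⁻¹ := by
        rw [div_eq_mul_inv R, mul_pow, pow_succ]
        field_simp
      have e2 : K * ((R / 4) ^ ((n : ℝ) * (1 - β)) * ω ^ (1 - β)) *
          ((η₀ / R) ^ ((n : ℝ) * (1 - α)) * ω ^ (1 - α)) =
          K * D * R ^ ((n : ℝ) * (α - β)) := by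
        have a1 : R ^ ((n : ℝ) * (α - β)) =
            R ^ ((n : ℝ) * (1 - β)) / R ^ ((n : ℝ) * (1 - α)) := by
          rw [← Real.rpow_sub hR0]; congr 1; ring
        rw [div_eq_mul_inv R, Real.mul_rpow hR0.le (by norm_num), Real.div_rpow hη₀.le hR0.le, a1,
          hD]
        ring
      rw [e1, e2] at hmain
      have a2 : R ^ ((n : ℝ) * (β - α) - 1) = R⁻¹ / R ^ ((n : ℝ) * (α - β)) := by
        rw [← Real.rpow_neg_one, ← Real.rpow_sub hR0]; congr 1; ring
      have hp : 0 < R ^ ((n : ℝ) * (α - β)) := by positivity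
      rw [a2, div_mul_div_comm, div_le_iff₀ (by positivity)]
      exact hmain.trans_eq (mul_assoc _ _ _)
    rw [le_div_iff₀ hn0]
    linarith
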